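/- Let $k$ be an algebraically closed field of characteristic two and let $m\ge 1$. For binary forms $A=a_0X^m+\dots+a_mY^m$ and $B=b_0X^{2m}+\dots+b_{2m}Y^{2m}$ over $k$, let $C(A,B)$ be the double cover of $\mathbb P^1$ given by $z^2+Az=B$, that is, $\operatorname{Spec}_{\mathbb P^1}(\mathcal O\oplus\mathcal O(-m))$ with the algebra structure $e^2=A(e)\,e+B(e^{\otimes 2})$. Concretely, $C(A,B)$ is obtained by gluing the affine curves $z^2+A(x,1)z=B(x,1)$ and $w^2+A(1,y)w=B(1,y)$ along $y=x^{-1}$, $w=x^{-m}z$. Identify the space of pairs $(A,B)$ with $\mathbb A^{3m+2}$, with coordinates $a_0,\dots,a_m,b_0,\dots,b_{2m}$, and let $\mathrm{Res}=\mathrm{Res}_{m,4m-2}$ be the resultant of binary forms of degrees $m$ and $4m-2$. Then: 1. There is a unique polynomial $\Delta\in k[a_0,\dots,a_m,b_0,\dots,b_{2m}]$ such that, for the generic forms $A,B$, $$\mathrm{Res}(A,\,A_X'^2B+B_X'^2)=a_0^2\,\Delta,\qquad \mathrm{Res}(A,\,A_Y'^2B+B_Y'^2)=a_m^2\,\Delta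 .$$ 2. If the $a_i$ have weight $1$ and the $b_j$ weight $2$, then $\Delta$ is weighted homogeneous of weight $8m-4$. For every form $\alpha$ of degree $m$, $\Delta(A,B+\alpha A+\alpha^2)=\Delta(A,B)$. For every $\sigma\in GL_2(k)$, $\Delta(A\circ\sigma,B\circ\sigma)=\det(\sigma)^{m(4m-2)}\Delta(A,B)$. 3. For all $(A,B)$, the curve $C(A,B)$ is smooth over $k$ if and only if $\Delta(A,B)\neq 0$. If $\Delta(A,B)=0$, $A\ne 0$ and the discriminant of the form $A$ is nonzero, then $C(A,B)$ is nodal (possibly reducible): all its singular points are ordinary double points. 4. $\Delta$ is an irreducible polynomial. 5. Let $Z\subset\mathbb A^{3m+2}$ be the set of pairs $(A,B)$ with $A\ne0$, $B\ne 0$ for which there is a linear form $\ell\neq 0$ with $\ell\mid A$ and $\ell^2\mid B$, and let the additive group $\mathbb G_a^{m+1}$ of binary forms $\alpha$ of degree $m$ act by $\alpha\cdot(A,B)=(A,B+\alpha A+\alpha^2)$. Then, with the Zariski closure, $$\{\Delta=0\}=\overline{\mathbb G_a^{m+1}\cdot Z}.$$ -/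

import Mathlib

namespace HyperellipticCurve

noncomputable section

open MvPolynomial CategoryTheory CategoryTheory.Limits AlgebraicGeometry

universe u

/-! ## The double cover of the projective line defined by a pair of binary forms -/

variable {k : Type u} [Field k]

theorem aeval_mul_of_isHomogeneous {S : Type*} [CommRing S] [Algebra k S] {n : ℕ}
    {F : MvPolynomial (Fin 2) k} (hF : F.IsHomogeneous n) (c : S) (v : Fin 2 → S) :
    aeval (fun i => c * v i) F = c ^ n * aeval v F := by
  rw [aeval_def, aeval_def, eval₂_eq, eval₂_eq, Finset.mul_sum]
  refine Finset.sum_congr rfl fun d hd => ?_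
  have hdeg := hF (mem_support_iff.mp hd)
  simp only [Finsupp.weight_apply, Finsupp.sum, Pi.one_apply, smul_eq_mul, mul_one] at hdeg
  simp only [mul_pow, Finset.prod_mul_distrib, Finset.prod_pow_eq_pow_sum, hdeg]
  ring

/-- The form `F(Y, X)`. -/
def swapForm (F : MvPolynomial (Fin 2) k) : MvPolynomial (Fin 2) k := aeval ![X 1, X 0] F

theorem swapForm_isHomogeneous {n : ℕ} {F : MvPolynomial (Fin 2) k} (hF : F.IsHomogeneous n) :
    (swapForm F).IsHomogeneous n := by
  have := hF.aeval (n := 1) (![X 1, X 0] : Fin 2 → MvPolynomial (Fin 2) k) (by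
    intro i; fin_cases i <;> simp [isHomogeneous_X])
  simpa [swapForm] using this

theorem aeval_swapForm {S : Type*} [CommRing S] [Algebra k S] (F : MvPolynomial (Fin 2) k)
    (a b : S) : aeval ![a, b] (swapForm F) = aeval ![b, a] F := by
  rw [swapForm, ← AlgHom.comp_apply]
  congr 1
  ext i; fin_cases i <;> simp

theorem swapForm_swapForm (F : MvPolynomial (Fin 2) k) : swapForm (swapForm F) = F := by
  conv_lhs => rw [swapForm, aeval_swapForm]
  have : (![X 0, X 1] : Fin 2 → MvPolynomial (Fin 2) k) = X := by
    ext i; fin_cases i <;> rfl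
  rw [this, aeval_X_left_apply]

/-- The plane curve `z² + A(x, 1) z = B(x, 1)`; the variables `X 0`, `X 1` are `x`, `z`. -/
def chartEquation (A B : MvPolynomial (Fin 2) k) : MvPolynomial (Fin 2) k :=
  X 1 ^ 2 + aeval ![X 0, 1] A * X 1 - aeval ![X 0, 1] B

/-- The coordinate ring `k[x, z] / (z² + A(x, 1) z - B(x, 1))` of the chart `Y ≠ 0`.
The chart `X ≠ 0`, with equation `w² + A(1, y) w = B(1, y)`, is the same ring for the swapped forms. -/
abbrev ChartRing (A B : MvPolynomial (Fin 2) k) : Type u :=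
  MvPolynomial (Fin 2) k ⧸ Ideal.span {chartEquation A B}

abbrev chartX (A B : MvPolynomial (Fin 2) k) : ChartRing A B := Ideal.Quotient.mk _ (X 0)
abbrev chartZ (A B : MvPolynomial (Fin 2) k) : ChartRing A B := Ideal.Quotient.mk _ (X 1)

/-- The coordinate ring of the open subset `x ≠ 0` of the chart `Y ≠ 0`. -/
abbrev OverlapRing (A B : MvPolynomial (Fin 2) k) : Type u := Localization.Away (chartX A B)

abbrev overlapX (A B : MvPolynomial (Fin 2) k) : OverlapRing A B :=
  algebraMap (ChartRing A B) _ (chartX A B)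
abbrev overlapZ (A B : MvPolynomial (Fin 2) k) : OverlapRing A B :=
  algebraMap (ChartRing A B) _ (chartZ A B)
abbrev overlapInv (A B : MvPolynomial (Fin 2) k) : OverlapRing A B :=
  IsLocalization.Away.invSelf (chartX A B)

theorem overlapX_mul_inv (A B : MvPolynomial (Fin 2) k) : overlapX A B * overlapInv A B = 1 :=
  IsLocalization.Away.mul_invSelf _

theorem overlap_equation (A B : MvPolynomial (Fin 2) k) :
    overlapZ A B ^ 2 + aeval ![overlapX A B, 1] A * overlapZ A B
      - aeval ![overlapX A B, 1] B = 0 := by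
  have h : Ideal.Quotient.mkₐ k (Ideal.span {chartEquation A B}) (chartEquation A B) = 0 :=
    Ideal.Quotient.eq_zero_iff_mem.mpr (Ideal.mem_span_singleton_self _)
  have h2 := congrArg (Algebra.ofId (ChartRing A B) (OverlapRing A B) |>.restrictScalars k) h
  rw [← AlgHom.comp_apply, map_zero] at h2
  have e : ∀ φ : MvPolynomial (Fin 2) k →ₐ[k] OverlapRing A B, φ (chartEquation A B) =
      φ (X 1) ^ 2 + φ (aeval ![X 0, 1] A) * φ (X 1) - φ (aeval ![X 0, 1] B) := by
    intro φ
    simp only [chartEquation, map_sub, map_add, map_mul, map_pow]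
  rw [e] at h2
  have key (F : MvPolynomial (Fin 2) k) :
      (((Algebra.ofId (ChartRing A B) (OverlapRing A B)).restrictScalars k).comp
        (Ideal.Quotient.mkₐ k (Ideal.span {chartEquation A B})))
        (aeval ![X 0, 1] F) = aeval ![overlapX A B, 1] F := by
    rw [← AlgHom.comp_apply]
    congr 1
    ext i; fin_cases i
    · simp [Algebra.ofId_apply]
    · simp
  rw [key, key] at h2
  exact h2

theorem aeval_overlapInv {n : ℕ} {A B F : MvPolynomial (Fin 2) k} (hF : F.IsHomogeneous n) :
    aeval ![overlapInv A B, 1] (swapForm F) =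
      overlapInv A B ^ n * aeval ![overlapX A B, 1] F := by
  rw [aeval_swapForm, ← aeval_mul_of_isHomogeneous hF]
  congr 2
  ext i; fin_cases i
  · simpa using (overlapX_mul_inv A B).symm.trans (mul_comm _ _)
  · simp

variable {m : ℕ} {A B A₁ B₁ : MvPolynomial (Fin 2) k}


/-- The change of charts `y = x⁻¹`, `w = x⁻ᵐ z`. -/
def chartTransition (hA : A.IsHomogeneous m) (hB : B.IsHomogeneous (2 * m))
    (hA₁ : A₁ = swapForm A) (hB₁ : B₁ = swapForm B) :
    ChartRing A₁ B₁ →ₐ[k] OverlapRing A B :=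
  Ideal.Quotient.liftₐ _ (aeval ![overlapInv A B, overlapInv A B ^ m * overlapZ A B]) (by
    intro a ha
    rw [← RingHom.mem_ker]
    refine (Ideal.span_singleton_le_iff_mem _).mpr ?_ ha
    rw [RingHom.mem_ker]
    have key (F : MvPolynomial (Fin 2) k) :
        aeval ![overlapInv A B, overlapInv A B ^ m * overlapZ A B]
          (aeval ![X 0, 1] F : MvPolynomial (Fin 2) k) = aeval ![overlapInv A B, 1] F := by
      rw [← AlgHom.comp_apply]
      congr 1
      ext i; fin_cases i <;> simp
    simp only [chartEquation, map_sub, map_add, map_mul, map_pow, key, hA₁, hB₁,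
      aeval_overlapInv hA, aeval_overlapInv hB, aeval_X]
    have := overlap_equation A B
    simp only [Matrix.cons_val_one, Matrix.cons_val_fin_one]
    linear_combination (overlapInv A B ^ (2 * m)) * this)

theorem chartTransition_X (hA : A.IsHomogeneous m) (hB : B.IsHomogeneous (2 * m))
    (hA₁ : A₁ = swapForm A) (hB₁ : B₁ = swapForm B) :
    chartTransition hA hB hA₁ hB₁ (chartX A₁ B₁) = overlapInv A B :=
  (aeval_X _ _).trans rfl

theorem chartTransition_Z (hA : A.IsHomogeneous m) (hB : B.IsHomogeneous (2 * m))
    (hA₁ : A₁ = swapForm A) (hB₁ : B₁ = swapForm B) :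
    chartTransition hA hB hA₁ hB₁ (chartZ A₁ B₁) = overlapInv A B ^ m * overlapZ A B :=
  (aeval_X _ _).trans rfl

def overlapTransition (hA : A.IsHomogeneous m) (hB : B.IsHomogeneous (2 * m))
    (hA₁ : A₁ = swapForm A) (hB₁ : B₁ = swapForm B) :
    OverlapRing A₁ B₁ →ₐ[k] OverlapRing A B :=
  IsLocalization.liftAlgHom (M := Submonoid.powers (chartX A₁ B₁))
    (f := chartTransition hA hB hA₁ hB₁) (by
      rintro ⟨_, n, rfl⟩
      simp only [map_pow]
      rw [chartTransition_X]
      exact (IsUnit.of_mul_eq_one_right _ (overlapX_mul_inv A B)).pow n)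

theorem overlapTransition_X (hA : A.IsHomogeneous m) (hB : B.IsHomogeneous (2 * m))
    (hA₁ : A₁ = swapForm A) (hB₁ : B₁ = swapForm B) :
    overlapTransition hA hB hA₁ hB₁ (overlapX A₁ B₁) = overlapInv A B :=
  (IsLocalization.lift_eq _ _).trans (chartTransition_X hA hB hA₁ hB₁)

theorem overlapTransition_Z (hA : A.IsHomogeneous m) (hB : B.IsHomogeneous (2 * m))
    (hA₁ : A₁ = swapForm A) (hB₁ : B₁ = swapForm B) :
    overlapTransition hA hB hA₁ hB₁ (overlapZ A₁ B₁) = overlapInv A B ^ m * overlapZ A B :=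
  (IsLocalization.lift_eq _ _).trans (chartTransition_Z hA hB hA₁ hB₁)

theorem overlapTransition_inv (hA : A.IsHomogeneous m) (hB : B.IsHomogeneous (2 * m))
    (hA₁ : A₁ = swapForm A) (hB₁ : B₁ = swapForm B) :
    overlapTransition hA hB hA₁ hB₁ (overlapInv A₁ B₁) = overlapX A B := by
  have h := congrArg (overlapTransition hA hB hA₁ hB₁) (overlapX_mul_inv A₁ B₁)
  rw [map_mul, map_one, overlapTransition_X] at h
  have h2 := overlapX_mul_inv A B
  linear_combination (overlapX A B) * h - overlapTransition hA hB hA₁ hB₁ (overlapInv A₁ B₁) * h2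

theorem overlap_algHom_eq_id (φ : OverlapRing A B →ₐ[k] OverlapRing A B)
    (hX : φ (overlapX A B) = overlapX A B) (hZ : φ (overlapZ A B) = overlapZ A B) :
    φ = AlgHom.id k _ := by
  apply AlgHom.coe_ringHom_injective
  refine IsLocalization.ringHom_ext (Submonoid.powers (chartX A B)) ?_
  refine Ideal.Quotient.ringHom_ext ?_
  refine MvPolynomial.ringHom_ext (fun r => ?_) (fun i => ?_)
  · exact (φ.commutes r).trans rfl
  · fin_cases i
    · exact hX
    · exact hZ

theorem overlapTransition_comp (hA : A.IsHomogeneous m) (hB : B.IsHomogeneous (2 * m))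
    (hA₁ : A₁ = swapForm A) (hB₁ : B₁ = swapForm B)
    (hA1 : A₁.IsHomogeneous m) (hB1 : B₁.IsHomogeneous (2 * m))
    (hA2 : A = swapForm A₁) (hB2 : B = swapForm B₁) :
    (overlapTransition hA hB hA₁ hB₁).comp (overlapTransition hA1 hB1 hA2 hB2) =
      AlgHom.id k _ := by
  apply overlap_algHom_eq_id
  · rw [AlgHom.comp_apply, overlapTransition_X, overlapTransition_inv]
  · rw [AlgHom.comp_apply, overlapTransition_Z, map_mul, map_pow, overlapTransition_inv,
      overlapTransition_Z, ← mul_assoc, ← mul_pow, overlapX_mul_inv, one_pow, one_mul]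

/-- The identification of the loci `y ≠ 0` and `x ≠ 0` in the two charts,
given by `y = x⁻¹`, `w = x⁻ᵐ z`. -/
def overlapEquiv (hA : A.IsHomogeneous m) (hB : B.IsHomogeneous (2 * m)) :
    OverlapRing (swapForm A) (swapForm B) ≃ₐ[k] OverlapRing A B :=
  AlgEquiv.ofAlgHom (overlapTransition hA hB rfl rfl)
    (overlapTransition (swapForm_isHomogeneous hA) (swapForm_isHomogeneous hB)
      (swapForm_swapForm A).symm (swapForm_swapForm B).symm)
    (overlapTransition_comp ..) (overlapTransition_comp ..)

/-- The locus `x ≠ 0` of the chart `Y ≠ 0`, as a scheme. -/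
abbrev overlap (A B : MvPolynomial (Fin 2) k) : Scheme.{u} := Spec (.of (OverlapRing A B))
/-- The chart `Y ≠ 0`, as a scheme. -/
abbrev chart (A B : MvPolynomial (Fin 2) k) : Scheme.{u} := Spec (.of (ChartRing A B))

/-- The inclusion of the overlap in the chart `Y ≠ 0`. -/
def overlapToLeft (A B : MvPolynomial (Fin 2) k) : overlap A B ⟶ chart A B :=
  Spec.map (CommRingCat.ofHom (algebraMap (ChartRing A B) (OverlapRing A B)))

/-- The inclusion of the overlap in the chart `X ≠ 0`. -/
def overlapToRight (hA : A.IsHomogeneous m) (hB : B.IsHomogeneous (2 * m)) :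
    overlap A B ⟶ chart (swapForm A) (swapForm B) :=
  Spec.map (overlapEquiv hA hB).toRingEquiv.toCommRingCatIso.hom ≫
    overlapToLeft (swapForm A) (swapForm B)

instance (A B : MvPolynomial (Fin 2) k) : IsOpenImmersion (overlapToLeft A B) :=
  AlgebraicGeometry.Scheme.isOpenImmersion_SpecMap_localizationAway (R := .of (ChartRing A B)) (chartX A B)

instance (hA : A.IsHomogeneous m) (hB : B.IsHomogeneous (2 * m)) :
    IsOpenImmersion (overlapToRight hA hB) := by
  unfold overlapToRight
  infer_instance

theorem hasPushout_of_isOpenImmersion {U V W : Scheme.{u}} (f : U ⟶ V) (g : U ⟶ W) [IsOpenImmersion f] [IsOpenImmersion g] :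
    HasPushout f g := by
  have (i j : WalkingSpan) (h : i ⟶ j) : IsOpenImmersion ((span f g).map h) := by
    rcases h with _ | (_ | _)
    · exact inferInstanceAs (IsOpenImmersion (𝟙 ((span f g).obj i)))
    · simpa
    · simpa
  have : ∀ {i j : WalkingSpan} (h : i ⟶ j), IsOpenImmersion ((span f g).map h) := this _ _
  infer_instance

instance (hA : A.IsHomogeneous m) (hB : B.IsHomogeneous (2 * m)) :
    HasPushout (overlapToLeft A B) (overlapToRight hA hB) :=
  hasPushout_of_isOpenImmersion _ _

/-- The curve `C(A, B) = Spec (𝒪 ⊕ 𝒪(-m))` with `e² = A e + B`, i.e. `z² + A z = B` over the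
projective line: the charts `z² + A(x, 1) z = B(x, 1)` and `w² + A(1, y) w = B(1, y)` glued
along `x ≠ 0`, `y ≠ 0` by `y = x⁻¹`, `w = x⁻ᵐ z`. -/
def curve (hA : A.IsHomogeneous m) (hB : B.IsHomogeneous (2 * m)) : Scheme.{u} :=
  pushout (overlapToLeft A B) (overlapToRight hA hB)

/-- The structure morphism of `C(A, B)`. -/
def curveToSpec (hA : A.IsHomogeneous m) (hB : B.IsHomogeneous (2 * m)) :
    curve hA hB ⟶ Spec (.of k) :=
  pushout.desc (Spec.map (CommRingCat.ofHom (algebraMap k (ChartRing A B))))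
    (Spec.map (CommRingCat.ofHom (algebraMap k (ChartRing (swapForm A) (swapForm B))))) (by
      have h : CommRingCat.ofHom (algebraMap k (ChartRing A B)) ≫
          CommRingCat.ofHom (algebraMap (ChartRing A B) (OverlapRing A B)) =
          CommRingCat.ofHom (algebraMap k (ChartRing (swapForm A) (swapForm B))) ≫
          CommRingCat.ofHom (algebraMap (ChartRing (swapForm A) (swapForm B))
            (OverlapRing (swapForm A) (swapForm B))) ≫
          (overlapEquiv hA hB).toRingEquiv.toCommRingCatIso.hom := by
        ext r
        exact ((overlapEquiv hA hB).commutes r).symm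
      simp only [overlapToLeft, overlapToRight, ← Spec.map_comp, h])

/-! ## Ordinary double points -/

/-- The point `p` is a singular point of the plane curve `f = 0`. -/
def IsSingularPoint (f : MvPolynomial (Fin 2) k) (p : Fin 2 → k) : Prop :=
  eval p f = 0 ∧ ∀ i, eval p (pderiv i f) = 0

/-- The point `p` is an ordinary double point (node) of the plane curve `f = 0`: it is singular and
the quadratic part of the expansion of `f` at `p` is a product of two independent linear forms. -/
def IsNode (f : MvPolynomial (Fin 2) k) (p : Fin 2 → k) : Prop :=
  IsSingularPoint f p ∧ ∃ u v : Fin 2 → k, LinearIndependent k ![u, v] ∧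
    homogeneousComponent 2 (aeval (fun i => X i + C (p i)) f : MvPolynomial (Fin 2) k) =
      (∑ i, C (u i) * X i) * (∑ i, C (v i) * X i)

/-- The curve `C(A, B)` is nodal: in both charts, every singular point is a node. -/
def IsNodalCurve (A B : MvPolynomial (Fin 2) k) : Prop :=
  (∀ p, IsSingularPoint (chartEquation A B) p → IsNode (chartEquation A B) p) ∧
  (∀ p, IsSingularPoint (chartEquation (swapForm A) (swapForm B)) p →
    IsNode (chartEquation (swapForm A) (swapForm B)) p)

/-! ## Coefficients, resultants and discriminants of binary forms -/

/-- The indices of the coordinates `a₀, …, aₘ, b₀, …, b₂ₘ`. -/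
abbrev CoeffIndex (m : ℕ) : Type := Fin (m + 1) ⊕ Fin (2 * m + 1)

/-- The binary form `∑ cᵢ Xⁿ⁻ⁱ Yⁱ`. -/
def binaryForm {R : Type*} [CommRing R] (n : ℕ) (c : Fin (n + 1) → R) : MvPolynomial (Fin 2) R :=
  ∑ i : Fin (n + 1), C (c i) * X 0 ^ (n - (i : ℕ)) * X 1 ^ (i : ℕ)

/-- The coefficients `cᵢ` of a binary form `∑ cᵢ Xⁿ⁻ⁱ Yⁱ`. -/
def formCoeff {R : Type*} [CommRing R] (n : ℕ) (F : MvPolynomial (Fin 2) R) : Fin (n + 1) → R :=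
  fun i => coeff (Finsupp.single 0 (n - (i : ℕ)) + Finsupp.single 1 (i : ℕ)) F

/-- The point of affine space of dimension `3 m + 2` defined by a pair of forms. -/
def pairCoeff (m : ℕ) (A B : MvPolynomial (Fin 2) k) : CoeffIndex m → k :=
  Sum.elim (formCoeff m A) (formCoeff (2 * m) B)

/-- The generic form `A` of degree `m`. -/
def genericA (k : Type*) [Field k] (m : ℕ) : MvPolynomial (Fin 2) (MvPolynomial (CoeffIndex m) k) :=
  binaryForm m (fun i => X (Sum.inl i))

/-- The generic form `B` of degree `2 m`. -/
def genericB (k : Type*) [Field k] (m : ℕ) : MvPolynomial (Fin 2) (MvPolynomial (CoeffIndex m) k) :=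
  binaryForm (2 * m) (fun j => X (Sum.inr j))

/-- The polynomial `F(x, 1)`. -/
def dehomogenize {R : Type*} [CommRing R] (F : MvPolynomial (Fin 2) R) : Polynomial R :=
  aeval ![Polynomial.X, 1] F

/-- The resultant `Res_{d,e}(F, G)` of two binary forms of degrees `d` and `e`. -/
def formResultant {R : Type*} [CommRing R] (d e : ℕ) (F G : MvPolynomial (Fin 2) R) : R :=
  Polynomial.resultant (dehomogenize F) (dehomogenize G) d e

/-- The discriminant of the generic binary form of degree `n`, as a polynomial in its
coefficients. -/
def genericDiscr (k : Type*) [Field k] (n : ℕ) : MvPolynomial (Fin (n + 1)) k :=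
  Polynomial.discr (dehomogenize (binaryForm n (fun i => (X i : MvPolynomial (Fin (n + 1)) k))))

/-- The discriminant of a binary form of degree `n`. -/
def formDiscr (n : ℕ) (F : MvPolynomial (Fin 2) k) : k :=
  eval (formCoeff n F) (genericDiscr k n)

/-- The two identities `Res(A, A_X² B + B_X²) = a₀² Δ` and `Res(A, A_Y² B + B_Y²) = aₘ² Δ`. -/
def IsDelta (m : ℕ) (Δ : MvPolynomial (CoeffIndex m) k) : Prop :=
  formResultant m (4 * m - 2) (genericA k m)
      (pderiv 0 (genericA k m) ^ 2 * genericB k m + pderiv 0 (genericB k m) ^ 2) =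
    X (Sum.inl 0) ^ 2 * Δ ∧
  formResultant m (4 * m - 2) (genericA k m)
      (pderiv 1 (genericA k m) ^ 2 * genericB k m + pderiv 1 (genericB k m) ^ 2) =
    X (Sum.inl (Fin.last m)) ^ 2 * Δ

/-- The value `Δ(A, B)`. -/
def evalPair (m : ℕ) (Δ : MvPolynomial (CoeffIndex m) k) (A B : MvPolynomial (Fin 2) k) : k :=
  eval (pairCoeff m A B) Δ

/-! ## Group actions -/

/-- The form `F ∘ σ`, for a linear change of variables `σ`. -/
def substForm (σ : GL (Fin 2) k) (F : MvPolynomial (Fin 2) k) : MvPolynomial (Fin 2) k :=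
  aeval (fun i => ∑ j, C ((σ : Matrix (Fin 2) (Fin 2) k) i j) * X j) F

/-- The pair `(A, B)` of forms of degrees `m` and `2 m` lies in `Z`: both are nonzero and there is
a nonzero linear form `ℓ` with `ℓ ∣ A` and `ℓ² ∣ B`. -/
def InZ (m : ℕ) (A B : MvPolynomial (Fin 2) k) : Prop :=
  A.IsHomogeneous m ∧ B.IsHomogeneous (2 * m) ∧ A ≠ 0 ∧ B ≠ 0 ∧
    ∃ l : MvPolynomial (Fin 2) k, l.IsHomogeneous 1 ∧ l ≠ 0 ∧ l ∣ A ∧ l ^ 2 ∣ B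

/-- The union of the orbits of the points of `Z` under the additive group of forms `α` of degree
`m`, which acts by `α · (A, B) = (A, B + α A + α²)`. -/
def orbitZ (k : Type*) [Field k] (m : ℕ) : Set (CoeffIndex m → k) :=
  {p | ∃ A B α : MvPolynomial (Fin 2) k, InZ m A B ∧ α.IsHomogeneous m ∧
    p = pairCoeff m A (B + α * A + α ^ 2)}

/-- The Zariski closure of a set of points of affine space. -/
def zariskiClosure {σ : Type*} (S : Set (σ → k)) : Set (σ → k) :=
  zeroLocus k (vanishingIdeal k S)

end

end HyperellipticCurve

namespace HyperellipticCurve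

open MvPolynomial

/-! ### Binary forms -/

section Forms

variable {k : Type*} [Field k]

/-! Write S₀ = A_X² B + B_X² and S₁ = A_Y² B + B_Y². If a₀ ≠ 0, then A = ∏ (aᵢ X + bᵢ Y) with all aᵢ
≠ 0. In characteristic two the roots are the points (bᵢ : aᵢ), so Res(A, S₀) = ∏ S₀(bᵢ, aᵢ). Euler's
relation gives x² S₀ = y² S₁ at every zero (x : y) of A, because deg B is even. Multiplying over the
roots gives aₘ² Res(A, S₀) = a₀² Res(A, S₁). Since a₀ and aₘ are non-associated primes, a₀² divides
Res(A, S₀), and the quotient is Δ (`exists_isDelta`).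

The product formula `IsDelta.prod_eval` yields the invariance statements when a₀ ≠ 0. The excluded
pairs are reached along lines in coefficient space: a polynomial in t that vanishes for all but
finitely many t is zero (`eq_zero_of_forall_eval_ne_zero`).

The formula also shows that Δ(A, B) = 0 exactly when A, S₀ and S₁ have a common zero on the
projective line (`IsDelta.evalPair_eq_zero_iff`; A = 0 needs its own argument). Over a zero of A the
curve has the single point z² = B. It is singular when A_X z = B_X in the chart, and squaring this
is S₀ = 0. Smoothness then follows from the Jacobian criterion, with an explicit obstruction to
lifting at a singular point. Where A has simple zeros, the quadratic part at a singular point has a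
nonzero mixed term, which in characteristic two makes it a node.

Translating by α with α² = B at the common zero turns the pair into one with ℓ ∣ A and ℓ² ∣ B
(`HasSingularFibre.exists_linForm`). Hence {Δ = 0} is the closure of the orbit of Z. It is also the
image of an affine space under a polynomial map, so it is irreducible as a set. On a suitable line Δ
has only simple zeros, so Δ is not a higher power and is irreducible as a polynomial
(`IsDelta.irreducible`). -/

/-- The linear form `a X + b Y`. -/
noncomputable def linForm {R : Type*} [CommRing R] (a b : R) : MvPolynomial (Fin 2) R :=
  C a * X 0 + C b * X 1

theorem linForm_isHomogeneous {R : Type*} [CommRing R] (a b : R) :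
    (linForm a b).IsHomogeneous 1 := by
  simpa [linForm] using ((isHomogeneous_C_mul_X a (0 : Fin 2)).add (isHomogeneous_C_mul_X b 1))

@[simp] theorem eval_linForm {R : Type*} [CommRing R] (a b : R) (p : Fin 2 → R) :
    eval p (linForm a b) = a * p 0 + b * p 1 := by
  simp [linForm]

theorem linForm_ne_zero {a b : k} (h : a ≠ 0 ∨ b ≠ 0) : linForm a b ≠ 0 := by
  intro h0
  have h1 := congrArg (eval ![1, 0]) h0
  have h2 := congrArg (eval ![0, 1]) h0
  simp at h1 h2
  tauto

theorem dehomogenize_linForm {R : Type*} [CommRing R] (a b : R) :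
    dehomogenize (linForm a b) = Polynomial.C a * Polynomial.X + Polynomial.C b := by
  simp [dehomogenize, linForm, Polynomial.algebraMap_eq]

theorem dehomogenize_mul {R : Type*} [CommRing R] (F G : MvPolynomial (Fin 2) R) :
    dehomogenize (F * G) = dehomogenize F * dehomogenize G := map_mul _ _ _

theorem homogenize_dehomogenize {R : Type*} [CommRing R] {n : ℕ} {F : MvPolynomial (Fin 2) R}
    (hF : F.IsHomogeneous n) : (dehomogenize F).homogenize n = F :=
  Polynomial.homogenize_eq_of_isHomogeneous hF rfl

theorem eq_of_dehomogenize_eq {R : Type*} [CommRing R] {n : ℕ} {F G : MvPolynomial (Fin 2) R}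
    (hF : F.IsHomogeneous n) (hG : G.IsHomogeneous n) (h : dehomogenize F = dehomogenize G) :
    F = G := by
  rw [← homogenize_dehomogenize hF, ← homogenize_dehomogenize hG, h]

theorem dehomogenize_homogenize {R : Type*} [CommRing R] {n : ℕ} {p : Polynomial R}
    (hp : p.natDegree ≤ n) : dehomogenize (p.homogenize n) = p :=
  Polynomial.aeval_homogenize_X_one p hp

theorem dehomogenize_C {R : Type*} [CommRing R] (c : R) :
    dehomogenize (C c) = Polynomial.C c := by
  simp [dehomogenize, Polynomial.algebraMap_eq]

theorem coeff_dehomogenize {R : Type*} [CommRing R] {n : ℕ} {F : MvPolynomial (Fin 2) R}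
    (hF : F.IsHomogeneous n) {i : ℕ} (hi : i ≤ n) :
    (dehomogenize F).coeff i = coeff (Finsupp.single 0 i + Finsupp.single 1 (n - i)) F := by
  conv_rhs => rw [← homogenize_dehomogenize hF, Polynomial.coeff_homogenize]
  simp [hi]

theorem natDegree_dehomogenize_le {R : Type*} [CommRing R] {n : ℕ} {F : MvPolynomial (Fin 2) R}
    (hF : F.IsHomogeneous n) : (dehomogenize F).natDegree ≤ n := by
  have h : dehomogenize F = ∑ d ∈ F.support, Polynomial.C (coeff d F) * Polynomial.X ^ d 0 := by
    conv_lhs => rw [F.as_sum, dehomogenize, map_sum]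
    refine Finset.sum_congr rfl fun d _ => ?_
    rw [aeval_monomial]
    simp [Finsupp.prod_fintype, Polynomial.algebraMap_eq]
  rw [h]
  refine Polynomial.natDegree_sum_le_of_forall_le _ _ fun d hd => ?_
  refine (Polynomial.natDegree_C_mul_X_pow_le _ _).trans ?_
  have := hF (mem_support_iff.mp hd)
  rw [Finsupp.weight_apply, Finsupp.sum_fintype _ _ (by simp)] at this
  simp [Fin.sum_univ_two] at this
  omega

theorem eval_dehomogenize {R : Type*} [CommRing R] (F : MvPolynomial (Fin 2) R) (x : R) :
    (dehomogenize F).eval x = eval ![x, 1] F := by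
  have h : (Polynomial.evalRingHom x).comp (aeval (R := R) ![Polynomial.X, 1]).toRingHom =
      eval ![x, 1] := by
    refine MvPolynomial.ringHom_ext (fun r => ?_) (fun i => ?_)
    · simp [Polynomial.algebraMap_eq]
    · fin_cases i <;> simp
  exact congrArg (fun φ : _ →+* R => φ F) h

/-- The point at infinity (1 : 0) is a zero of the form exactly when the dehomogenized polynomial
drops below its formal degree. -/
theorem coeff_dehomogenize_top {R : Type*} [CommRing R] {n : ℕ} {F : MvPolynomial (Fin 2) R}
    (hF : F.IsHomogeneous n) : (dehomogenize F).coeff n = eval ![1, 0] F := by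
  have h : eval ![1, 0] F = ∑ d ∈ F.support, coeff d F * 0 ^ d 1 := by
    conv_lhs => rw [F.as_sum, map_sum]
    refine Finset.sum_congr rfl fun d _ => ?_
    simp [eval_monomial, Finsupp.prod_fintype]
  rw [coeff_dehomogenize hF le_rfl, h, Nat.sub_self]
  rw [Finset.sum_eq_single (Finsupp.single 0 n + Finsupp.single 1 0)]
  · simp
  · intro d hd hne
    have := hF (mem_support_iff.mp hd)
    rw [Finsupp.weight_apply, Finsupp.sum_fintype _ _ (by simp)] at this
    simp [Fin.sum_univ_two] at this
    by_cases h1 : d 1 = 0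
    · exact absurd (by ext i; fin_cases i <;> simp <;> omega) hne
    · simp [h1]
  · intro h
    simpa using notMem_support_iff.mp h

theorem eval_smul_of_isHomogeneous {R : Type*} [CommRing R] {n : ℕ} {F : MvPolynomial (Fin 2) R}
    (hF : F.IsHomogeneous n) (c x y : R) : eval ![c * x, c * y] F = c ^ n * eval ![x, y] F := by
  have h : eval ![c * x, c * y] F = ∑ d ∈ F.support, coeff d F * ((c * x) ^ d 0 * (c * y) ^ d 1) := by
    conv_lhs => rw [F.as_sum, map_sum]
    refine Finset.sum_congr rfl fun d _ => ?_
    simp [eval_monomial, Finsupp.prod_fintype]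
  have h' : eval ![x, y] F = ∑ d ∈ F.support, coeff d F * (x ^ d 0 * y ^ d 1) := by
    conv_lhs => rw [F.as_sum, map_sum]
    refine Finset.sum_congr rfl fun d _ => ?_
    simp [eval_monomial, Finsupp.prod_fintype]
  rw [h, h', Finset.mul_sum]
  refine Finset.sum_congr rfl fun d hd => ?_
  have := hF (mem_support_iff.mp hd)
  rw [Finsupp.weight_apply, Finsupp.sum_fintype _ _ (by simp)] at this
  simp [Fin.sum_univ_two] at this
  rw [← this]; ring

/-- A binary form vanishing at a nonzero point is divisible by the corresponding linear form. -/
theorem exists_eq_linForm_mul [CharP k 2] {n : ℕ} {F : MvPolynomial (Fin 2) k}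
    (hF : F.IsHomogeneous (n + 1)) {x y : k} (hxy : x ≠ 0 ∨ y ≠ 0) (h : eval ![x, y] F = 0) :
    ∃ G : MvPolynomial (Fin 2) k, G.IsHomogeneous n ∧ F = linForm y x * G := by
  have hdeg := natDegree_dehomogenize_le hF
  by_cases hy : y = 0
  -- Zero at infinity: the linear form is x Y, which dehomogenizes to the constant x, so division by
  -- it only lowers the formal degree.
  · subst hy
    have hx : x ≠ 0 := by simpa using hxy
    have h0 : eval ![(1 : k), 0] F = 0 := by
      have := eval_smul_of_isHomogeneous hF x 1 0
      rw [mul_one, mul_zero, h] at this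
      simpa [hx] using this.symm
    rw [← coeff_dehomogenize_top hF] at h0
    have hlt : (dehomogenize F).natDegree ≤ n := by
      rw [Polynomial.natDegree_le_iff_coeff_eq_zero]
      intro N hN
      rcases Nat.lt_or_ge (n + 1) N with h1 | h1
      · exact Polynomial.coeff_eq_zero_of_natDegree_lt (hdeg.trans_lt h1)
      · rwa [show N = n + 1 by omega]
    refine ⟨C x⁻¹ * (dehomogenize F).homogenize n,
      (Polynomial.isHomogeneous_homogenize _).C_mul _, ?_⟩
    refine eq_of_dehomogenize_eq hF ?_ ?_
    · rw [add_comm]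
      exact (linForm_isHomogeneous _ _).mul ((Polynomial.isHomogeneous_homogenize _).C_mul _)
    · rw [dehomogenize_mul, dehomogenize_mul, dehomogenize_linForm, dehomogenize_homogenize hlt,
        dehomogenize_C, Polynomial.C_0, zero_mul, zero_add, ← mul_assoc, ← Polynomial.C_mul,
        mul_inv_cancel₀ hx, Polynomial.C_1, one_mul]
  -- Finite zero: in characteristic two y X + x Y = y (X - (x / y) Y), so this is division by the
  -- root x / y.
  · have h0 : (dehomogenize F).IsRoot (x / y) := by
      rw [Polynomial.IsRoot, eval_dehomogenize]
      have := eval_smul_of_isHomogeneous hF y (x / y) 1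
      rw [mul_div_cancel₀ _ hy, mul_one, h] at this
      simpa [hy] using this.symm
    obtain ⟨q, hq⟩ := Polynomial.dvd_iff_isRoot.mpr h0
    have hqd : q.natDegree ≤ n := by
      by_cases hq0 : q = 0
      · simp [hq0]
      · rw [hq, Polynomial.natDegree_mul (Polynomial.X_sub_C_ne_zero _) hq0,
          Polynomial.natDegree_X_sub_C] at hdeg
        omega
    refine ⟨C y⁻¹ * q.homogenize n, (Polynomial.isHomogeneous_homogenize _).C_mul _, ?_⟩
    refine eq_of_dehomogenize_eq hF ?_ ?_
    · rw [add_comm]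
      exact (linForm_isHomogeneous _ _).mul ((Polynomial.isHomogeneous_homogenize _).C_mul _)
    · rw [dehomogenize_mul, dehomogenize_mul, dehomogenize_linForm, hq,
        dehomogenize_homogenize hqd, dehomogenize_C]
      have h2 : (Polynomial.C y * Polynomial.C y⁻¹ : Polynomial k) = 1 := by
        rw [← Polynomial.C_mul, mul_inv_cancel₀ hy, Polynomial.C_1]
      rw [CharTwo.sub_eq_add, div_eq_mul_inv, Polynomial.C_mul]
      linear_combination (-Polynomial.X * q) * h2

/-- If (1 : 0) is not a zero, the dehomogenized polynomial has full degree n + 1 > 0 and hence a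
root. -/
theorem exists_zero_of_isHomogeneous [IsAlgClosed k] {n : ℕ} {F : MvPolynomial (Fin 2) k}
    (hF : F.IsHomogeneous (n + 1)) : ∃ x y : k, (x ≠ 0 ∨ y ≠ 0) ∧ eval ![x, y] F = 0 := by
  by_cases h : eval ![(1 : k), 0] F = 0
  · exact ⟨1, 0, by simp, h⟩
  · rw [← coeff_dehomogenize_top hF] at h
    have hd : (dehomogenize F).degree ≠ 0 := by
      intro hd
      have := Polynomial.le_degree_of_ne_zero h
      rw [hd] at this
      norm_cast at this
    obtain ⟨x, hx⟩ := IsAlgClosed.exists_root _ hd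
    exact ⟨x, 1, by simp, by rwa [← eval_dehomogenize]⟩

/-- Over an algebraically closed field, a binary form is a product of linear forms. -/
theorem exists_eq_prod_linForm [CharP k 2] [IsAlgClosed k] (n : ℕ) :
    ∀ {F : MvPolynomial (Fin 2) k}, F.IsHomogeneous (n + 1) →
      ∃ a b : Fin (n + 1) → k, F = ∏ i, linForm (a i) (b i) := by
  induction n with
  | zero =>
    intro F hF
    obtain ⟨x, y, hxy, h⟩ := exists_zero_of_isHomogeneous hF
    obtain ⟨G, hG, rfl⟩ := exists_eq_linForm_mul hF hxy h
    rw [← totalDegree_zero_iff_isHomogeneous, totalDegree_eq_zero_iff_eq_C] at hG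
    refine ⟨fun _ => y * coeff 0 G, fun _ => x * coeff 0 G, ?_⟩
    rw [Fin.prod_univ_one]
    conv_lhs => rw [hG]
    simp only [linForm, C_mul]; ring
  | succ n ih =>
    intro F hF
    obtain ⟨x, y, hxy, h⟩ := exists_zero_of_isHomogeneous hF
    obtain ⟨G, hG, rfl⟩ := exists_eq_linForm_mul hF hxy h
    obtain ⟨a, b, rfl⟩ := ih hG
    refine ⟨Fin.cons y a, Fin.cons x b, ?_⟩
    rw [Fin.prod_univ_succ (fun i => linForm ((Fin.cons y a : Fin (n + 1 + 1) → k) i)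
      ((Fin.cons x b : Fin (n + 1 + 1) → k) i))]
    simp only [Fin.cons_zero, Fin.cons_succ]

/-- The root is b / a, and the constant factor a contributes aⁿ, which exactly clears the
denominators of G(b / a, 1). -/
theorem formResultant_linForm [CharP k 2] {n : ℕ} {a : k} (ha : a ≠ 0) (b : k)
    {G : MvPolynomial (Fin 2) k} (hG : G.IsHomogeneous n) :
    Polynomial.resultant (dehomogenize (linForm a b)) (dehomogenize G) 1 n = eval ![b, a] G := by
  have h : dehomogenize (linForm a b) =
      Polynomial.C a * (Polynomial.X - Polynomial.C (b / a)) := by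
    rw [dehomogenize_linForm, mul_sub, ← Polynomial.C_mul, mul_div_cancel₀ _ ha,
      CharTwo.sub_eq_add]
  rw [h, Polynomial.resultant_C_mul_left,
    Polynomial.resultant_X_sub_C_left _ _ _ (natDegree_dehomogenize_le hG), eval_dehomogenize,
    ← eval_smul_of_isHomogeneous hG, mul_one, mul_div_cancel₀ _ ha]

/-- The resultant of a product of linear forms with a form. -/
theorem formResultant_prod_linForm [CharP k 2] {ι : Type*} (s : Finset ι) {a b : ι → k}
    (ha : ∀ i ∈ s, a i ≠ 0) {n : ℕ} {G : MvPolynomial (Fin 2) k} (hG : G.IsHomogeneous n) :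
    formResultant s.card n (∏ i ∈ s, linForm (a i) (b i)) G =
      ∏ i ∈ s, eval ![b i, a i] G := by
  have hlc : ∀ i ∈ s, (dehomogenize (linForm (a i) (b i))).leadingCoeff = a i := fun i hi => by
    rw [dehomogenize_linForm, Polynomial.leadingCoeff_linear (ha i hi)]
  have hnd : ∀ i ∈ s, (dehomogenize (linForm (a i) (b i))).natDegree = 1 := fun i hi => by
    rw [dehomogenize_linForm, Polynomial.natDegree_linear (ha i hi)]
  have hprod : ∏ i ∈ s, (dehomogenize (linForm (a i) (b i))).leadingCoeff ≠ 0 := by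
    rw [Finset.prod_congr rfl hlc]
    exact Finset.prod_ne_zero_iff.mpr ha
  have h := Polynomial.resultant_prod_left s (fun i => dehomogenize (linForm (a i) (b i)))
    (dehomogenize G) n hprod (natDegree_dehomogenize_le hG)
  rw [Polynomial.natDegree_prod' _ _ hprod, Finset.sum_congr rfl hnd, Finset.sum_const, smul_eq_mul,
    mul_one] at h
  have h2 : dehomogenize (∏ i ∈ s, linForm (a i) (b i)) =
      ∏ i ∈ s, dehomogenize (linForm (a i) (b i)) := map_prod _ _ _
  rw [formResultant, h2, h]
  refine Finset.prod_congr rfl fun i hi => ?_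
  rw [hnd i hi, formResultant_linForm (ha i hi) _ hG]

end Forms

/-! ### Coefficients of forms -/

section Coefficients

variable {R : Type*} [CommRing R]

theorem binaryForm_isHomogeneous (n : ℕ) (c : Fin (n + 1) → R) :
    (binaryForm n c).IsHomogeneous n := by
  refine IsHomogeneous.sum _ _ _ fun i _ => ?_
  have h := ((isHomogeneous_X_pow (R := R) (0 : Fin 2) (n - (i : ℕ))).C_mul (c i)).mul
    (isHomogeneous_X_pow (R := R) (1 : Fin 2) (i : ℕ))
  rwa [Nat.sub_add_cancel (by omega)] at h

theorem map_binaryForm {S : Type*} [CommRing S] (φ : R →+* S) (n : ℕ) (c : Fin (n + 1) → R) :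
    map φ (binaryForm n c) = binaryForm n (fun i => φ (c i)) := by
  simp [binaryForm, map_sum]

theorem formCoeff_binaryForm (n : ℕ) (c : Fin (n + 1) → R) : formCoeff n (binaryForm n c) = c := by
  ext i
  rw [formCoeff, binaryForm, coeff_sum]
  rw [Finset.sum_eq_single i]
  · rw [mul_assoc, coeff_C_mul, X_pow_eq_monomial, X_pow_eq_monomial, monomial_mul, coeff_monomial]
    simp
  · intro j _ hj
    rw [mul_assoc, coeff_C_mul, X_pow_eq_monomial, X_pow_eq_monomial, monomial_mul, coeff_monomial,
      if_neg, mul_zero]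
    intro h
    have := DFunLike.congr_fun h 1
    simp at this
    exact hj (Fin.ext this)
  · simp

theorem binaryForm_formCoeff {n : ℕ} {F : MvPolynomial (Fin 2) R} (hF : F.IsHomogeneous n) :
    binaryForm n (formCoeff n F) = F := by
  refine eq_of_dehomogenize_eq (binaryForm_isHomogeneous _ _) hF ?_
  ext i
  rcases Nat.lt_or_ge n i with hi | hi
  · rw [Polynomial.coeff_eq_zero_of_natDegree_lt, Polynomial.coeff_eq_zero_of_natDegree_lt]
    · exact (natDegree_dehomogenize_le hF).trans_lt hi
    · exact (natDegree_dehomogenize_le (binaryForm_isHomogeneous _ _)).trans_lt hi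
  · rw [coeff_dehomogenize (binaryForm_isHomogeneous _ _) hi, coeff_dehomogenize hF hi]
    have := congrFun (formCoeff_binaryForm n (formCoeff n F)) ⟨n - i, by omega⟩
    simpa [formCoeff, Nat.sub_sub_self hi] using this

theorem formCoeff_add (n : ℕ) (F G : MvPolynomial (Fin 2) R) :
    formCoeff n (F + G) = formCoeff n F + formCoeff n G := by
  ext i; simp [formCoeff]

theorem formCoeff_C_mul (n : ℕ) (c : R) (F : MvPolynomial (Fin 2) R) :
    formCoeff n (C c * F) = c • formCoeff n F := by
  ext i; simp [formCoeff, coeff_C_mul]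

theorem formCoeff_map {S : Type*} [CommRing S] (φ : R →+* S) (n : ℕ) (F : MvPolynomial (Fin 2) R)
    (i : Fin (n + 1)) : formCoeff n (map φ F) i = φ (formCoeff n F i) := by
  simp [formCoeff, coeff_map]

theorem formCoeff_zero_eq {n : ℕ} {F : MvPolynomial (Fin 2) R} (hF : F.IsHomogeneous n) :
    formCoeff n F 0 = eval ![1, 0] F := by
  rw [← coeff_dehomogenize_top hF, coeff_dehomogenize hF le_rfl]
  simp [formCoeff]

theorem formCoeff_last_eq {n : ℕ} {F : MvPolynomial (Fin 2) R} (hF : F.IsHomogeneous n) :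
    formCoeff n F (Fin.last n) = eval ![0, 1] F := by
  rw [← eval_dehomogenize, ← Polynomial.coeff_zero_eq_eval_zero, coeff_dehomogenize hF n.zero_le]
  simp [formCoeff]

theorem map_dehomogenize {S : Type*} [CommRing S] (φ : R →+* S) (F : MvPolynomial (Fin 2) R) :
    (dehomogenize F).map φ = dehomogenize (map φ F) := by
  have h : (Polynomial.mapRingHom φ).comp (aeval (R := R) ![Polynomial.X, 1]).toRingHom =
      (aeval (R := S) ![Polynomial.X, 1]).toRingHom.comp (map φ) := by
    refine MvPolynomial.ringHom_ext (fun r => ?_) (fun i => ?_)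
    · simp [Polynomial.algebraMap_eq]
    · fin_cases i <;> simp
  exact congrArg (fun ψ : _ →+* Polynomial S => ψ F) h

/-- The formal degrees stay fixed, so specialization commutes with the resultant even where leading
coefficients vanish. -/
theorem map_formResultant {S : Type*} [CommRing S] (φ : R →+* S) (d e : ℕ)
    (F G : MvPolynomial (Fin 2) R) :
    φ (formResultant d e F G) = formResultant d e (map φ F) (map φ G) := by
  rw [formResultant, ← Polynomial.resultant_map_map, map_dehomogenize, map_dehomogenize]
  rfl

end Coefficients

end HyperellipticCurve

namespace HyperellipticCurve

open MvPolynomial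

/-! ### Polynomial functions on curves in affine space -/

section Paths

variable {k : Type*} [Field k]

theorem eval_aeval_path {σ : Type*} (P : MvPolynomial σ k) (c : σ → Polynomial k) (t : k) :
    (aeval c P).eval t = eval (fun i => (c i).eval t) P := by
  have h : (Polynomial.evalRingHom t).comp (aeval (R := k) c).toRingHom =
      eval (fun i => (c i).eval t) := by
    refine MvPolynomial.ringHom_ext (fun r => ?_) (fun i => ?_)
    · simp [Polynomial.algebraMap_eq]
    · simp
  exact congrArg (fun φ : _ →+* k => φ P) h

/-- The density argument on a line: it extends identities known off a proper closed set, cut out by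
g, to all values of the parameter, in particular to t = 0. -/
theorem eq_zero_of_forall_eval_ne_zero [Infinite k] {p g : Polynomial k} (hg : g ≠ 0)
    (h : ∀ t, g.eval t ≠ 0 → p.eval t = 0) : p = 0 := by
  have : p * g = 0 := by
    refine Polynomial.funext fun t => ?_
    rw [Polynomial.eval_mul, Polynomial.eval_zero]
    by_cases ht : g.eval t = 0
    · rw [ht, mul_zero]
    · rw [h t ht, zero_mul]
  exact (mul_eq_zero.mp this).resolve_right hg

theorem C_add_C_mul_X_ne_zero (u : k) {v : k} (hv : v ≠ 0) :
    Polynomial.C u + Polynomial.C v * Polynomial.X ≠ 0 := by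
  intro h
  have := congrArg (fun p => Polynomial.coeff p 1) h
  simp [Polynomial.coeff_C] at this
  exact hv this

theorem pairCoeff_add_C_mul {m : ℕ} (A B A' B' : MvPolynomial (Fin 2) k) (t : k) :
    pairCoeff m (A + C t * A') (B + C t * B') = pairCoeff m A B + t • pairCoeff m A' B' := by
  ext (i | i) <;> simp [pairCoeff, formCoeff_add, formCoeff_C_mul]

theorem exists_eval_line_eq {σ : Type*} (P : MvPolynomial σ k) (u v : σ → k) :
    ∃ p : Polynomial k, ∀ t, p.eval t = eval (u + t • v) P := by
  refine ⟨aeval (fun i => Polynomial.C (u i) + Polynomial.C (v i) * Polynomial.X) P, fun t => ?_⟩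
  rw [eval_aeval_path]
  congr 2
  ext i
  simp only [Polynomial.eval_add, Polynomial.eval_mul, Polynomial.eval_C, Polynomial.eval_X,
    Pi.add_apply, Pi.smul_apply, smul_eq_mul, mul_comm t]

theorem exists_evalPair_line_eq {m : ℕ} (P : MvPolynomial (CoeffIndex m) k)
    (A B A' B' : MvPolynomial (Fin 2) k) :
    ∃ p : Polynomial k, ∀ t, p.eval t = evalPair m P (A + C t * A') (B + C t * B') := by
  obtain ⟨p, hp⟩ := exists_eval_line_eq P (pairCoeff m A B) (pairCoeff m A' B')
  exact ⟨p, fun t => by rw [hp, evalPair, pairCoeff_add_C_mul]⟩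

end Paths

/-! ### The forms `A_X² B + B_X²` and `A_Y² B + B_Y²` -/

section SingForm

/-- The forms `A_X² B + B_X²` (for `i = 0`) and `A_Y² B + B_Y²` (for `i = 1`). -/
noncomputable def singForm {R : Type*} [CommRing R] (i : Fin 2) (A B : MvPolynomial (Fin 2) R) :
    MvPolynomial (Fin 2) R :=
  pderiv i A ^ 2 * B + pderiv i B ^ 2

theorem map_singForm {R S : Type*} [CommRing R] [CommRing S] (φ : R →+* S) (i : Fin 2)
    (A B : MvPolynomial (Fin 2) R) :
    map φ (singForm i A B) = singForm i (map φ A) (map φ B) := by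
  simp [singForm, pderiv_map]

variable {k : Type*} [Field k] {m : ℕ} {A B : MvPolynomial (Fin 2) k}

theorem singForm_isHomogeneous (hm : 1 ≤ m) (hA : A.IsHomogeneous m) (hB : B.IsHomogeneous (2 * m))
    (i : Fin 2) : (singForm i A B).IsHomogeneous (4 * m - 2) := by
  have h1 := ((hA.pderiv (i := i)).pow 2).mul hB
  have h2 := (hB.pderiv (i := i)).pow 2
  rw [show (m - 1) * 2 + 2 * m = 4 * m - 2 by omega] at h1
  rw [show (2 * m - 1) * 2 = 4 * m - 2 by omega] at h2
  exact h1.add h2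

theorem eval_euler {n : ℕ} {F : MvPolynomial (Fin 2) k} (hF : F.IsHomogeneous n) (p : Fin 2 → k) :
    p 0 * eval p (pderiv 0 F) + p 1 * eval p (pderiv 1 F) = n * eval p F := by
  have := congrArg (eval p) hF.sum_X_mul_pderiv
  simpa [Fin.sum_univ_two] using this

/-- Euler gives x A_X + y A_Y = 0 at a zero of A, and x B_X + y B_Y = 2m B = 0 everywhere. The claim
is a combination of the two differences of squares. -/
theorem sq_mul_eval_singForm [CharP k 2] (hA : A.IsHomogeneous m) (hB : B.IsHomogeneous (2 * m))
    {p : Fin 2 → k} (hp : eval p A = 0) :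
    p 0 ^ 2 * eval p (singForm 0 A B) = p 1 ^ 2 * eval p (singForm 1 A B) := by
  have h1 := eval_euler hA p
  have h2 := eval_euler hB p
  rw [hp, mul_zero] at h1
  rw [Nat.cast_mul, show ((2 : ℕ) : k) = 0 from CharP.cast_eq_zero k 2, zero_mul, zero_mul] at h2
  simp only [singForm, map_add, map_mul, map_pow]
  linear_combination eval p B * (p 0 * eval p (pderiv 0 A) - p 1 * eval p (pderiv 1 A)) * h1 +
    (p 0 * eval p (pderiv 0 B) - p 1 * eval p (pderiv 1 B)) * h2

/-- The form `A_X² B + B_X²` changes by a multiple of `A` under `B ↦ B + α A + α²`. -/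
theorem singForm_add_mul_add_sq [CharP k 2] (i : Fin 2) (A B α : MvPolynomial (Fin 2) k) :
    singForm i A (B + α * A + α ^ 2) =
      singForm i A B + A * (pderiv i A ^ 2 * α + pderiv i α ^ 2 * A) := by
  have h2 : (2 : MvPolynomial (Fin 2) k) = 0 := CharTwo.two_eq_zero
  have h : pderiv i (B + α * A + α ^ 2) = pderiv i B + pderiv i α * A + α * pderiv i A := by
    simp only [map_add, Derivation.leibniz, Derivation.leibniz_pow, smul_eq_mul, nsmul_eq_mul]
    push_cast
    rw [h2]; ring
  rw [singForm, singForm, h]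
  linear_combination (α ^ 2 * pderiv i A ^ 2 + pderiv i B * pderiv i α * A +
    pderiv i B * α * pderiv i A + pderiv i α * A * α * pderiv i A) * h2

end SingForm

/-! ### Existence and uniqueness of `Δ` -/

section Delta

variable {k : Type*} [Field k] {m : ℕ}

theorem map_eval_genericA (c : CoeffIndex m → k) :
    map (eval c) (genericA k m) = binaryForm m (fun i => c (Sum.inl i)) := by
  simp [genericA, map_binaryForm]

theorem map_eval_genericB (c : CoeffIndex m → k) :
    map (eval c) (genericB k m) = binaryForm (2 * m) (fun i => c (Sum.inr i)) := by
  simp [genericB, map_binaryForm]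

theorem pairCoeff_binaryForm (c : CoeffIndex m → k) :
    pairCoeff m (binaryForm m (fun i => c (Sum.inl i)))
      (binaryForm (2 * m) (fun i => c (Sum.inr i))) = c := by
  ext (i | i) <;> simp [pairCoeff, formCoeff_binaryForm]

theorem eval_formResultant_generic (c : CoeffIndex m → k) (i : Fin 2) :
    eval c (formResultant m (4 * m - 2) (genericA k m)
      (singForm i (genericA k m) (genericB k m))) =
    formResultant m (4 * m - 2) (binaryForm m (fun i => c (Sum.inl i)))
      (singForm i (binaryForm m (fun i => c (Sum.inl i)))
        (binaryForm (2 * m) (fun i => c (Sum.inr i)))) := by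
  rw [map_formResultant, map_singForm, map_eval_genericA, map_eval_genericB]

theorem eval_prod_linForm_one_zero {R : Type*} [CommRing R] {n : ℕ} (a b : Fin n → R) :
    eval ![1, 0] (∏ i, linForm (a i) (b i)) = ∏ i, a i := by
  simp [map_prod]

theorem eval_prod_linForm_zero_one {R : Type*} [CommRing R] {n : ℕ} (a b : Fin n → R) :
    eval ![0, 1] (∏ i, linForm (a i) (b i)) = ∏ i, b i := by
  simp [map_prod]

theorem eval_prod_linForm_root [CharP k 2] {n : ℕ} (a b : Fin n → k) (i : Fin n) :
    eval ![b i, a i] (∏ i, linForm (a i) (b i)) = 0 := by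
  rw [map_prod]
  refine Finset.prod_eq_zero (Finset.mem_univ i) ?_
  simp [mul_comm, CharTwo.add_self_eq_zero]

/-- A form of positive degree not vanishing at `(1, 0)` is a product of linear forms with nonzero
first coefficient. -/
theorem exists_eq_prod_linForm_of_eval_ne_zero [IsAlgClosed k] [CharP k 2] (hm : 1 ≤ m)
    {A : MvPolynomial (Fin 2) k} (hA : A.IsHomogeneous m) (h0 : eval ![1, 0] A ≠ 0) :
    ∃ a b : Fin m → k, A = ∏ i, linForm (a i) (b i) ∧ ∀ i, a i ≠ 0 := by
  obtain ⟨n, rfl⟩ := Nat.exists_eq_add_of_le' hm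
  obtain ⟨a, b, rfl⟩ := exists_eq_prod_linForm n hA
  rw [eval_prod_linForm_one_zero] at h0
  exact ⟨a, b, rfl, fun i => Finset.prod_ne_zero_iff.mp h0 i (Finset.mem_univ i)⟩

theorem formResultant_prod_linForm_univ [CharP k 2] {a b : Fin m → k} (ha : ∀ i, a i ≠ 0) {n : ℕ}
    {G : MvPolynomial (Fin 2) k} (hG : G.IsHomogeneous n) :
    formResultant m n (∏ i, linForm (a i) (b i)) G = ∏ i, eval ![b i, a i] G := by
  have := formResultant_prod_linForm Finset.univ (b := b) (fun i _ => ha i) hG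
  rwa [Finset.card_univ, Fintype.card_fin] at this

/-- The product of the pointwise relation b² S₀ = a² S₁ over the roots (bᵢ, aᵢ), with a₀ = ∏ aᵢ and
aₘ = ∏ bᵢ. -/
theorem sq_mul_formResultant_singForm [IsAlgClosed k] [CharP k 2] (hm : 1 ≤ m)
    {A B : MvPolynomial (Fin 2) k} (hA : A.IsHomogeneous m) (hB : B.IsHomogeneous (2 * m))
    (h0 : eval ![1, 0] A ≠ 0) :
    eval ![0, 1] A ^ 2 * formResultant m (4 * m - 2) A (singForm 0 A B) =
      eval ![1, 0] A ^ 2 * formResultant m (4 * m - 2) A (singForm 1 A B) := by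
  obtain ⟨a, b, hab, ha⟩ := exists_eq_prod_linForm_of_eval_ne_zero hm hA h0
  have h : ∀ i, b i ^ 2 * eval ![b i, a i] (singForm 0 A B) =
      a i ^ 2 * eval ![b i, a i] (singForm 1 A B) := fun i => by
    simpa using sq_mul_eval_singForm hA hB (p := ![b i, a i])
      (by rw [hab]; exact eval_prod_linForm_root a b i)
  have e0 := formResultant_prod_linForm_univ ha (b := b) (singForm_isHomogeneous hm hA hB 0)
  have e1 := formResultant_prod_linForm_univ ha (b := b) (singForm_isHomogeneous hm hA hB 1)
  have h01 : eval ![0, 1] A = ∏ i, b i := by rw [hab, eval_prod_linForm_zero_one]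
  have h10 : eval ![1, 0] A = ∏ i, a i := by rw [hab, eval_prod_linForm_one_zero]
  rw [← hab] at e0 e1
  rw [e0, e1, h01, h10, ← Finset.prod_pow, ← Finset.prod_pow, ← Finset.prod_mul_distrib,
    ← Finset.prod_mul_distrib]
  exact Finset.prod_congr rfl fun i _ => h i

theorem exists_isDelta [IsAlgClosed k] [CharP k 2] (hm : 1 ≤ m) :
    ∃ Δ : MvPolynomial (CoeffIndex m) k, IsDelta m Δ := by
  have := IsAlgClosed.instInfinite (K := k)
  set f := formResultant m (4 * m - 2) (genericA k m)
    (singForm 0 (genericA k m) (genericB k m)) with hf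
  set g := formResultant m (4 * m - 2) (genericA k m)
    (singForm 1 (genericA k m) (genericB k m)) with hg
  have hX : (X (Sum.inl 0) : MvPolynomial (CoeffIndex m) k) ≠ 0 := X_ne_zero _
  have key : X (Sum.inl (Fin.last m)) ^ 2 * f = X (Sum.inl 0) ^ 2 * g := by
    -- The extra factor a₀ makes the identity trivial at the points with a₀ = 0, where the
    -- factorization with nonzero aᵢ is unavailable.
    refine mul_left_cancel₀ hX (MvPolynomial.funext fun c => ?_)
    have hA := binaryForm_isHomogeneous m (fun i => c (Sum.inl i))
    have hB := binaryForm_isHomogeneous (2 * m) (fun i => c (Sum.inr i))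
    have h0 := formCoeff_zero_eq hA
    have h1 := formCoeff_last_eq hA
    rw [formCoeff_binaryForm] at h0 h1
    by_cases hc : c (Sum.inl 0) = 0
    · simp [hc]
    · have := sq_mul_formResultant_singForm hm hA hB (by rwa [← h0])
      rw [← h0, ← h1] at this
      simp only [map_mul, map_pow, eval_X, hf, hg, eval_formResultant_generic, this]
  -- The variable a₀ is prime and, as m ≥ 1, differs from aₘ; so its square must divide the other
  -- factor.
  have hdvd : X (Sum.inl 0) ^ 2 ∣ f := by
    refine (X_prime (R := k) (i := (Sum.inl 0 : CoeffIndex m))).pow_dvd_of_dvd_mul_left 2 ?_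
      (Dvd.intro _ key.symm)
    intro h
    have := (X_prime (R := k) (i := (Sum.inl 0 : CoeffIndex m))).dvd_of_dvd_pow h
    rw [X_dvd_X, Sum.inl.injEq, Fin.ext_iff] at this
    simp at this
    omega
  obtain ⟨Δ, hΔ⟩ := hdvd
  refine ⟨Δ, hΔ, ?_⟩
  refine mul_left_cancel₀ (pow_ne_zero 2 hX) (key.symm.trans ?_)
  rw [hΔ]; ring

theorem IsDelta.unique {Δ Δ₁ : MvPolynomial (CoeffIndex m) k} (h : IsDelta m Δ)
    (h₁ : IsDelta m Δ₁) : Δ₁ = Δ :=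
  mul_left_cancel₀ (pow_ne_zero 2 (X_ne_zero (Sum.inl 0))) (h₁.1.symm.trans h.1)

variable {Δ : MvPolynomial (CoeffIndex m) k} {A B : MvPolynomial (Fin 2) k}

theorem binaryForm_pairCoeff_inl (hA : A.IsHomogeneous m) :
    binaryForm m (fun i => pairCoeff m A B (Sum.inl i)) = A := binaryForm_formCoeff hA

theorem binaryForm_pairCoeff_inr (hB : B.IsHomogeneous (2 * m)) :
    binaryForm (2 * m) (fun i => pairCoeff m A B (Sum.inr i)) = B := binaryForm_formCoeff hB

theorem IsDelta.formResultant_zero (h : IsDelta m Δ) (hA : A.IsHomogeneous m)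
    (hB : B.IsHomogeneous (2 * m)) :
    formResultant m (4 * m - 2) A (singForm 0 A B) = eval ![1, 0] A ^ 2 * evalPair m Δ A B := by
  have := congrArg (eval (pairCoeff m A B)) h.1
  rw [← singForm, eval_formResultant_generic, binaryForm_pairCoeff_inl hA,
    binaryForm_pairCoeff_inr hB, map_mul, map_pow, eval_X] at this
  rw [this, ← formCoeff_zero_eq hA]
  rfl

/-- The formula for `Δ` in terms of the linear factors of `A`. -/
theorem IsDelta.prod_eval [CharP k 2] (h : IsDelta m Δ) (hm : 1 ≤ m) {a b : Fin m → k}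
    (ha : ∀ i, a i ≠ 0) (hA : A.IsHomogeneous m) (hB : B.IsHomogeneous (2 * m))
    (hab : A = ∏ i, linForm (a i) (b i)) :
    (∏ i, a i) ^ 2 * evalPair m Δ A B = ∏ i, eval ![b i, a i] (singForm 0 A B) := by
  have h1 := h.formResultant_zero hA hB
  have h2 : eval ![1, 0] A = ∏ i, a i := by rw [hab, eval_prod_linForm_one_zero]
  have h3 := formResultant_prod_linForm_univ ha (b := b) (singForm_isHomogeneous hm hA hB 0)
  rw [← h2, ← h1, ← h3, ← hab]

end Delta

end HyperellipticCurve

namespace HyperellipticCurve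

open MvPolynomial

/-! ### Weight, translations and linear changes of variables -/

section Weight

variable {k : Type*} [Field k]

theorem coeff_aeval_C_mul_X {σ : Type*} (c : σ → k) (P : MvPolynomial σ k) (d : σ →₀ ℕ) :
    coeff d (aeval (fun i => C (c i) * X i : σ → MvPolynomial σ k) P) =
      (d.prod fun i e => c i ^ e) * coeff d P := by
  classical
  induction P using MvPolynomial.induction_on' with
  | monomial e r =>
    have h : aeval (fun i => C (c i) * X i : σ → MvPolynomial σ k) (monomial e r) =
        monomial e ((e.prod fun i e => c i ^ e) * r) := by
      rw [aeval_monomial, monomial_eq (a := _ * r)]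
      simp only [mul_pow, Finsupp.prod_mul, C_mul, algebraMap_eq]
      rw [show C (e.prod fun i e => c i ^ e) =
        e.prod fun i e => (C (c i) : MvPolynomial σ k) ^ e by
          simp [Finsupp.prod, map_prod]]
      ring
    rw [h, coeff_monomial, coeff_monomial]
    split_ifs with hd
    · rw [hd]
    · rw [mul_zero]
  | add p q hp hq => rw [map_add, coeff_add, coeff_add, hp, hq, mul_add]

/-- Comparing coefficients, every monomial d of P satisfies t ^ weight(d) = tⁿ for all t ≠ 0, which
over an infinite field forces weight(d) = n. The polynomial Q allows the scaling identity to be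
checked on a dense open set only. -/
theorem isWeightedHomogeneous_of_eval [Infinite k] {σ : Type*} (w : σ → ℕ)
    {P Q : MvPolynomial σ k} (n : ℕ) (hQ : Q ≠ 0)
    (h : ∀ t : k, t ≠ 0 → ∀ x : σ → k, eval x Q ≠ 0 →
      eval (fun i => t ^ w i * x i) P = t ^ n * eval x P) :
    IsWeightedHomogeneous w P n := by
  intro d hd
  have h1 : ∀ t : k, t ≠ 0 → t ^ (Finsupp.weight w d) = t ^ n := by
    intro t ht
    have : aeval (fun i => C (t ^ w i) * X i : σ → MvPolynomial σ k) P = C (t ^ n) * P := by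
      refine mul_left_cancel₀ hQ (MvPolynomial.funext fun x => ?_)
      rw [map_mul, map_mul, map_mul, eval_C]
      by_cases hx : eval x Q = 0
      · rw [hx, zero_mul, zero_mul]
      rw [← h t ht x hx, ← aeval_eq_eval, ← aeval_eq_eval, ← AlgHom.comp_apply, comp_aeval]
      simp
    have h2 := congrArg (coeff d) this
    rw [coeff_aeval_C_mul_X, coeff_C_mul] at h2
    have h3 := mul_right_cancel₀ hd h2
    rw [← h3, Finsupp.weight_apply, Finsupp.sum, Finsupp.prod, ← Finset.prod_pow_eq_pow_sum]
    refine Finset.prod_congr rfl fun i _ => ?_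
    rw [smul_eq_mul, mul_comm, pow_mul]
  have h2 : (Polynomial.X ^ (Finsupp.weight w d) : Polynomial k) = Polynomial.X ^ n := by
    refine mul_left_cancel₀ (Polynomial.X_ne_zero (R := k)) (Polynomial.funext fun t => ?_)
    by_cases ht : t = 0
    · simp [ht]
    · simpa [ht] using h1 t ht
  simpa using congrArg Polynomial.natDegree h2

end Weight

/-! ### Linear changes of variables, and the weight of Δ -/

section Substitution

variable {k : Type*} [Field k] {m : ℕ} {Δ : MvPolynomial (CoeffIndex m) k}

theorem evalPair_binaryForm (c : CoeffIndex m → k) :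
    evalPair m Δ (binaryForm m (fun i => c (Sum.inl i)))
      (binaryForm (2 * m) (fun i => c (Sum.inr i))) = eval c Δ := by
  rw [evalPair, pairCoeff_binaryForm]

theorem IsDelta.formResultant_generic (h : IsDelta m Δ) (c : CoeffIndex m → k) :
    formResultant m (4 * m - 2) (binaryForm m (fun i => c (Sum.inl i)))
      (singForm 0 (binaryForm m (fun i => c (Sum.inl i)))
        (binaryForm (2 * m) (fun i => c (Sum.inr i)))) = c (Sum.inl 0) ^ 2 * eval c Δ := by
  rw [h.formResultant_zero (binaryForm_isHomogeneous _ _) (binaryForm_isHomogeneous _ _),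
    evalPair_binaryForm, ← formCoeff_zero_eq (binaryForm_isHomogeneous _ _), formCoeff_binaryForm]

theorem binaryForm_mul_left {R : Type*} [CommRing R] (n : ℕ) (t : R) (c : Fin (n + 1) → R) :
    binaryForm n (fun i => t * c i) = C t * binaryForm n c := by
  simp [binaryForm, Finset.mul_sum, mul_assoc]

/-- The chain rule. -/
theorem pderiv_aeval {R : Type*} [CommRing R] {σ τ : Type*} [Fintype σ]
    (f : σ → MvPolynomial τ R) (j : τ) (F : MvPolynomial σ R) :
    pderiv j (aeval f F) = ∑ i, aeval f (pderiv i F) * pderiv j (f i) := by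
  classical
  induction F using MvPolynomial.induction_on with
  | C r => simp
  | add p q hp hq => simp only [map_add, hp, hq, add_mul, Finset.sum_add_distrib]
  | mul_X p i hp =>
    simp only [map_mul, aeval_X, pderiv_mul, hp, pderiv_X, map_add, add_mul,
      Finset.sum_add_distrib, Finset.sum_mul]
    congr 1
    · exact Finset.sum_congr rfl fun _ _ => by ring
    · rw [Finset.sum_eq_single i]
      · simp
      · intro b _ hb
        simp [Pi.single_eq_of_ne' hb]
      · simp

theorem eval_substForm (σ : GL (Fin 2) k) (F : MvPolynomial (Fin 2) k) (p : Fin 2 → k) :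
    eval p (substForm σ F) =
      eval ![(σ : Matrix (Fin 2) (Fin 2) k) 0 0 * p 0 + (σ : Matrix (Fin 2) (Fin 2) k) 0 1 * p 1,
        (σ : Matrix (Fin 2) (Fin 2) k) 1 0 * p 0 + (σ : Matrix (Fin 2) (Fin 2) k) 1 1 * p 1] F := by
  rw [substForm, ← aeval_eq_eval, ← aeval_eq_eval, ← AlgHom.comp_apply, comp_aeval]
  congr 2
  ext i; fin_cases i <;> simp [Fin.sum_univ_two]

theorem substForm_isHomogeneous (σ : GL (Fin 2) k) {n : ℕ} {F : MvPolynomial (Fin 2) k}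
    (hF : F.IsHomogeneous n) : (substForm σ F).IsHomogeneous n := by
  have := hF.aeval (n := 1)
    (fun i => ∑ j, C ((σ : Matrix (Fin 2) (Fin 2) k) i j) * X j : Fin 2 → MvPolynomial (Fin 2) k)
    fun i => IsHomogeneous.sum _ _ _ fun j _ => isHomogeneous_C_mul_X _ _
  rwa [one_mul] at this

theorem pderiv_substForm (σ : GL (Fin 2) k) (F : MvPolynomial (Fin 2) k) (j : Fin 2) :
    pderiv j (substForm σ F) =
      C ((σ : Matrix (Fin 2) (Fin 2) k) 0 j) * substForm σ (pderiv 0 F) +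
        C ((σ : Matrix (Fin 2) (Fin 2) k) 1 j) * substForm σ (pderiv 1 F) := by
  have : ∀ i, pderiv j (∑ l, C ((σ : Matrix (Fin 2) (Fin 2) k) i l) * X l :
      MvPolynomial (Fin 2) k) = C ((σ : Matrix (Fin 2) (Fin 2) k) i j) := by
    intro i
    fin_cases j <;> simp [Fin.sum_univ_two, pderiv_X]
  rw [substForm, pderiv_aeval, Fin.sum_univ_two, this, this, substForm, substForm]
  ring

theorem substForm_linForm (σ : GL (Fin 2) k) (a b : k) :
    substForm σ (linForm a b) =
      linForm (a * (σ : Matrix (Fin 2) (Fin 2) k) 0 0 + b * (σ : Matrix (Fin 2) (Fin 2) k) 1 0)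
        (a * (σ : Matrix (Fin 2) (Fin 2) k) 0 1 + b * (σ : Matrix (Fin 2) (Fin 2) k) 1 1) := by
  simp only [substForm, linForm, map_add, map_mul, algHom_C, algebraMap_eq, aeval_X,
    Fin.sum_univ_two]
  ring

/-- Supplies a direction M such that A + t M is nonzero at two prescribed points for all but
finitely many t. Here Xⁿ works unless x = 0, and then (X + Y)ⁿ does. -/
theorem exists_isHomogeneous_eval_ne_zero (n : ℕ) {x y : k} (h : x ≠ 0 ∨ y ≠ 0) :
    ∃ M : MvPolynomial (Fin 2) k, M.IsHomogeneous n ∧ eval ![1, 0] M ≠ 0 ∧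
      eval ![x, y] M ≠ 0 := by
  by_cases hx : x = 0
  · refine ⟨(linForm 1 1) ^ n, by simpa using (linForm_isHomogeneous (1 : k) 1).pow n, ?_, ?_⟩
    · simp
    · have hy : y ≠ 0 := by tauto
      simp [hx, hy]
  · exact ⟨(X 0) ^ n, isHomogeneous_X_pow _ _, by simp, by simp [hx]⟩

/-- These two entries are the coordinates of the image of (1, 0) under σ. -/
theorem row_ne_zero_of_GL (σ : GL (Fin 2) k) :
    (σ : Matrix (Fin 2) (Fin 2) k) 0 0 ≠ 0 ∨ (σ : Matrix (Fin 2) (Fin 2) k) 1 0 ≠ 0 := by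
  by_contra! h
  have hdet := Matrix.det_fin_two (σ : Matrix (Fin 2) (Fin 2) k)
  rw [h.1, h.2, zero_mul, mul_zero, sub_zero] at hdet
  exact (Matrix.isUnits_det_units σ).ne_zero hdet

/-- By the chain rule the first derivatives transform linearly; in characteristic two squaring is
additive, so their squares transform by the squared matrix entries without cross terms. -/
theorem singForm_substForm [CharP k 2] (σ : GL (Fin 2) k) (A B : MvPolynomial (Fin 2) k) (j : Fin 2) :
    singForm j (substForm σ A) (substForm σ B) =
      C ((σ : Matrix (Fin 2) (Fin 2) k) 0 j) ^ 2 * substForm σ (singForm 0 A B) +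
        C ((σ : Matrix (Fin 2) (Fin 2) k) 1 j) ^ 2 * substForm σ (singForm 1 A B) := by
  have h2 : (2 : MvPolynomial (Fin 2) k) = 0 := CharTwo.two_eq_zero
  have h : ∀ i, substForm σ (singForm i A B) =
      substForm σ (pderiv i A) ^ 2 * substForm σ B + substForm σ (pderiv i B) ^ 2 := fun i => by
    simp [singForm, substForm]
  rw [h, h, singForm, pderiv_substForm, pderiv_substForm]
  linear_combination (C ((σ : Matrix (Fin 2) (Fin 2) k) 0 j) *
    C ((σ : Matrix (Fin 2) (Fin 2) k) 1 j) * (substForm σ (pderiv 0 A) * substForm σ (pderiv 1 A) *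
      substForm σ B + substForm σ (pderiv 0 B) * substForm σ (pderiv 1 B))) * h2

theorem IsDelta.isWeightedHomogeneous [Infinite k] (h : IsDelta m Δ) (hm : 1 ≤ m) :
    IsWeightedHomogeneous (Sum.elim (fun _ => 1) (fun _ => 2) : CoeffIndex m → ℕ) Δ
      (8 * m - 4) := by
  have hX : (X (Sum.inl 0) : MvPolynomial (CoeffIndex m) k) ≠ 0 := X_ne_zero _
  refine isWeightedHomogeneous_of_eval _ _ hX fun t ht c hc => ?_
  rw [eval_X] at hc
  have e1 := h.formResultant_generic c
  have e2 := h.formResultant_generic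
    (fun i => t ^ (Sum.elim (fun _ => 1) (fun _ => 2) : CoeffIndex m → ℕ) i * c i)
  simp only [Sum.elim_inl, Sum.elim_inr, binaryForm_mul_left, pow_one] at e2
  have e3 : singForm 0 (C t * binaryForm m (fun i => c (Sum.inl i)))
      (C (t ^ 2) * binaryForm (2 * m) (fun i => c (Sum.inr i))) =
      C (t ^ 4) * singForm 0 (binaryForm m (fun i => c (Sum.inl i)))
        (binaryForm (2 * m) (fun i => c (Sum.inr i))) := by
    rw [singForm, singForm, pderiv_C_mul, pderiv_C_mul, C_pow, C_pow]; ring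
  rw [e3, formResultant, dehomogenize_mul, dehomogenize_mul, dehomogenize_C, dehomogenize_C,
    Polynomial.resultant_C_mul_left, Polynomial.resultant_C_mul_right] at e2
  rw [formResultant] at e1
  rw [e1] at e2
  have hc2 : (t * c (Sum.inl 0)) ^ 2 ≠ 0 := pow_ne_zero 2 (mul_ne_zero ht hc)
  -- S₀ has weight 4, so scaling multiplies Res(A, S₀) by t ^ (4m - 2) · t ^ (4m). Dividing by the
  -- weight 2 of a₀² leaves 8m - 4.
  have e4 : t ^ (4 * m - 2) * (t ^ 4) ^ m = t ^ 2 * t ^ (8 * m - 4) := by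
    rw [← pow_mul, ← pow_add, ← pow_add]; congr 1; omega
  refine mul_left_cancel₀ hc2 (e2.symm.trans ?_)
  linear_combination (c (Sum.inl 0) ^ 2 * eval c Δ) * e4

end Substitution

/-! ### Invariance under translations and semi-invariance under GL(2) -/

section Invariance

variable {k : Type*} [Field k] [IsAlgClosed k] [CharP k 2] {m : ℕ}
  {Δ : MvPolynomial (CoeffIndex m) k} {A B : MvPolynomial (Fin 2) k}

/-- Translation changes S₀ by a multiple of A, so the values of S₀ at the roots of A, and with them
the product formula, are unchanged. -/
theorem IsDelta.evalPair_add_mul_add_sq_of_ne_zero (h : IsDelta m Δ) (hm : 1 ≤ m)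
    {α : MvPolynomial (Fin 2) k} (hA : A.IsHomogeneous m) (hB : B.IsHomogeneous (2 * m))
    (hα : α.IsHomogeneous m) (h0 : eval ![1, 0] A ≠ 0) :
    evalPair m Δ A (B + α * A + α ^ 2) = evalPair m Δ A B := by
  obtain ⟨a, b, hab, ha⟩ := exists_eq_prod_linForm_of_eval_ne_zero hm hA h0
  have hB' : (B + α * A + α ^ 2).IsHomogeneous (2 * m) :=
    (hB.add (by rw [two_mul]; exact hα.mul hA)).add (by rw [mul_comm]; exact hα.pow 2)
  refine mul_left_cancel₀ (pow_ne_zero 2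
    (Finset.prod_ne_zero_iff.mpr fun i (_ : i ∈ Finset.univ) => ha i)) ?_
  rw [h.prod_eval hm ha hA hB' hab, h.prod_eval hm ha hA hB hab]
  refine Finset.prod_congr rfl fun i _ => ?_
  have : eval ![b i, a i] A = 0 := by rw [hab]; exact eval_prod_linForm_root a b i
  rw [singForm_add_mul_add_sq, map_add, map_mul, this, zero_mul, add_zero]

theorem IsDelta.evalPair_add_mul_add_sq (h : IsDelta m Δ) (hm : 1 ≤ m)
    {α : MvPolynomial (Fin 2) k} (hA : A.IsHomogeneous m) (hB : B.IsHomogeneous (2 * m))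
    (hα : α.IsHomogeneous m) :
    evalPair m Δ A (B + α * A + α ^ 2) = evalPair m Δ A B := by
  have := IsAlgClosed.instInfinite (K := k)
  have hM : (X 0 ^ m : MvPolynomial (Fin 2) k).IsHomogeneous m := isHomogeneous_X_pow _ _
  -- The direction α Xᵐ in the second component keeps the moving pair equal to the translate by α of
  -- (A + t Xᵐ, B).
  obtain ⟨p, hp⟩ := exists_evalPair_line_eq Δ A (B + α * A + α ^ 2) (X 0 ^ m) (α * X 0 ^ m)
  obtain ⟨q, hq⟩ := exists_evalPair_line_eq Δ A B (X 0 ^ m) 0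
  have hpq : p - q = 0 := by
    refine eq_zero_of_forall_eval_ne_zero
      (C_add_C_mul_X_ne_zero (eval ![1, 0] A) one_ne_zero) fun t ht => ?_
    have hAt : (A + C t * X 0 ^ m).IsHomogeneous m := hA.add (hM.C_mul t)
    have e : B + α * A + α ^ 2 + C t * (α * X 0 ^ m) = B + α * (A + C t * X 0 ^ m) + α ^ 2 := by
      ring
    rw [Polynomial.eval_sub, hp, hq, mul_zero, add_zero, e,
      h.evalPair_add_mul_add_sq_of_ne_zero hm hAt hB hα, sub_self]
    simpa using ht
  have h1 := hp 0
  have h2 := hq 0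
  simp only [C_0, zero_mul, add_zero] at h1 h2
  rw [← h1, ← h2, sub_eq_zero.mp hpq]

theorem IsDelta.evalPair_substForm_of_ne_zero (h : IsDelta m Δ) (hm : 1 ≤ m)
    (σ : GL (Fin 2) k) (hA : A.IsHomogeneous m) (hB : B.IsHomogeneous (2 * m))
    (h0 : eval ![1, 0] A ≠ 0) (h1 : eval ![1, 0] (substForm σ A) ≠ 0) :
    evalPair m Δ (substForm σ A) (substForm σ B) =
      (σ : Matrix (Fin 2) (Fin 2) k).det ^ (m * (4 * m - 2)) * evalPair m Δ A B := by
  obtain ⟨a, b, hab, ha⟩ := exists_eq_prod_linForm_of_eval_ne_zero hm hA h0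
  have hB' := singForm_isHomogeneous hm hA hB 0
  have hB1 := singForm_isHomogeneous hm hA hB 1
  have hsub : substForm σ A = ∏ i, linForm
      (a i * (σ : Matrix (Fin 2) (Fin 2) k) 0 0 + b i * (σ : Matrix (Fin 2) (Fin 2) k) 1 0)
      (a i * (σ : Matrix (Fin 2) (Fin 2) k) 0 1 + b i * (σ : Matrix (Fin 2) (Fin 2) k) 1 1) := by
    rw [hab]
    simp only [← substForm_linForm]
    exact map_prod _ _ _
  have ha' : ∀ i, a i * (σ : Matrix (Fin 2) (Fin 2) k) 0 0 +
      b i * (σ : Matrix (Fin 2) (Fin 2) k) 1 0 ≠ 0 := by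
    rw [hsub, eval_prod_linForm_one_zero] at h1
    exact fun i => Finset.prod_ne_zero_iff.mp h1 i (Finset.mem_univ i)
  have e1 := h.prod_eval hm ha hA hB hab
  have e2 := h.prod_eval hm ha' (substForm_isHomogeneous σ hA) (substForm_isHomogeneous σ hB) hsub
  have h2 : (2 : k) = 0 := CharTwo.two_eq_zero
  have hdet := Matrix.det_fin_two (σ : Matrix (Fin 2) (Fin 2) k)
  -- The new root is mapped by σ to det(σ) · (bᵢ, aᵢ), and S₀, S₁ have degree 4m - 2, which gives
  -- the power of the determinant. With s, u the first column of σ, the relation b² S₀ = a² S₁ turns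
  -- a² (s² S₀ + u² S₁) into (a s + b u)² S₀, and a s + b u is the new leading coefficient.
  have e3 : ∀ i, a i ^ 2 * eval ![a i * (σ : Matrix (Fin 2) (Fin 2) k) 0 1 +
        b i * (σ : Matrix (Fin 2) (Fin 2) k) 1 1, a i * (σ : Matrix (Fin 2) (Fin 2) k) 0 0 +
        b i * (σ : Matrix (Fin 2) (Fin 2) k) 1 0]
        (singForm 0 (substForm σ A) (substForm σ B)) =
      (σ : Matrix (Fin 2) (Fin 2) k).det ^ (4 * m - 2) *
        (a i * (σ : Matrix (Fin 2) (Fin 2) k) 0 0 + b i * (σ : Matrix (Fin 2) (Fin 2) k) 1 0) ^ 2 *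
        eval ![b i, a i] (singForm 0 A B) := by
    intro i
    have hr : b i ^ 2 * eval ![b i, a i] (singForm 0 A B) =
        a i ^ 2 * eval ![b i, a i] (singForm 1 A B) := by
      simpa using sq_mul_eval_singForm hA hB (p := ![b i, a i])
        (by rw [hab]; exact eval_prod_linForm_root a b i)
    rw [singForm_substForm, map_add, map_mul, map_mul, map_pow, map_pow, eval_C, eval_C,
      eval_substForm, eval_substForm]
    simp only [Matrix.cons_val_zero, Matrix.cons_val_one, Matrix.cons_val_fin_one]
    generalize (σ : Matrix (Fin 2) (Fin 2) k).det = D at *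
    generalize (σ : Matrix (Fin 2) (Fin 2) k) 0 0 = s at *
    generalize (σ : Matrix (Fin 2) (Fin 2) k) 0 1 = s' at *
    generalize (σ : Matrix (Fin 2) (Fin 2) k) 1 0 = u at *
    generalize (σ : Matrix (Fin 2) (Fin 2) k) 1 1 = u' at *
    -- The rows of the adjugate relation σ(b', a') = det(σ) (b, a); the sign discrepancies are
    -- multiples of 2.
    have p1 : s * (a i * s' + b i * u') + s' * (a i * s + b i * u) = D * b i := by
      linear_combination (a i * s * s' + b i * s' * u) * h2 - b i * hdet
    have p2 : u * (a i * s' + b i * u') + u' * (a i * s + b i * u) = D * a i := by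
      linear_combination (a i * u * s' + b i * u * u') * h2 - a i * hdet
    rw [p1, p2, eval_smul_of_isHomogeneous hB', eval_smul_of_isHomogeneous hB1]
    linear_combination (-(D ^ (4 * m - 2)) * u ^ 2) * hr -
      (D ^ (4 * m - 2) * a i * b i * s * u * eval ![b i, a i] (singForm 0 A B)) * h2
  have e4 := Finset.prod_congr (rfl : (Finset.univ : Finset (Fin m)) = _) fun i _ => e3 i
  rw [Finset.prod_mul_distrib, Finset.prod_mul_distrib, Finset.prod_mul_distrib, Finset.prod_pow _ 2 a,
    Finset.prod_pow, Finset.prod_pow, Finset.prod_const, Finset.card_univ, Fintype.card_fin, ← e1, ← e2] at e4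
  have n1 := pow_ne_zero 2 (Finset.prod_ne_zero_iff.mpr fun i (_ : i ∈ Finset.univ) => ha i)
  have n2 := pow_ne_zero 2 (Finset.prod_ne_zero_iff.mpr fun i (_ : i ∈ Finset.univ) => ha' i)
  refine mul_left_cancel₀ (mul_ne_zero n1 n2) ?_
  rw [mul_comm m, pow_mul]
  linear_combination e4

theorem IsDelta.evalPair_substForm (h : IsDelta m Δ) (hm : 1 ≤ m) (σ : GL (Fin 2) k)
    (hA : A.IsHomogeneous m) (hB : B.IsHomogeneous (2 * m)) :
    evalPair m Δ (substForm σ A) (substForm σ B) =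
      (σ : Matrix (Fin 2) (Fin 2) k).det ^ (m * (4 * m - 2)) * evalPair m Δ A B := by
  have := IsAlgClosed.instInfinite (K := k)
  obtain ⟨M, hM, hM0, hM1⟩ := exists_isHomogeneous_eval_ne_zero m (row_ne_zero_of_GL σ)
  obtain ⟨p, hp⟩ := exists_evalPair_line_eq Δ (substForm σ A) (substForm σ B) (substForm σ M) 0
  obtain ⟨q, hq⟩ := exists_evalPair_line_eq Δ A B M 0
  have hM1' : eval ![1, 0] (substForm σ M) ≠ 0 := by rw [eval_substForm]; simpa using hM1
  have hpq : p - Polynomial.C ((σ : Matrix (Fin 2) (Fin 2) k).det ^ (m * (4 * m - 2))) * q = 0 := by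
    refine eq_zero_of_forall_eval_ne_zero (mul_ne_zero
      (C_add_C_mul_X_ne_zero (eval ![1, 0] A) hM0)
      (C_add_C_mul_X_ne_zero (eval ![1, 0] (substForm σ A)) hM1')) fun t ht => ?_
    rw [Polynomial.eval_mul] at ht
    have e : substForm σ A + C t * substForm σ M = substForm σ (A + C t * M) := by
      simp [substForm]
    rw [Polynomial.eval_sub, Polynomial.eval_mul, Polynomial.eval_C, hp, hq, mul_zero, add_zero,
      add_zero, e, h.evalPair_substForm_of_ne_zero hm σ (hA.add (hM.C_mul t)) hB,
      sub_self]
    · rw [map_add, map_mul, eval_C, mul_comm t]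
      simpa using left_ne_zero_of_mul ht
    · rw [← e, map_add, map_mul, eval_C, mul_comm t]
      simpa using right_ne_zero_of_mul ht
  have h1 := hp 0
  have h2 := hq 0
  simp only [C_0, zero_mul, add_zero] at h1 h2
  rw [← h1, ← h2, sub_eq_zero.mp hpq, Polynomial.eval_mul, Polynomial.eval_C]

end Invariance

end HyperellipticCurve

namespace HyperellipticCurve

open MvPolynomial

/-! ### The zero locus of `Δ` -/

section ZeroLocus

variable {k : Type*} [Field k] {m : ℕ} {A B : MvPolynomial (Fin 2) k}

/-- There is a point of the projective line over which the curve `C(A, B)` is singular. -/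
def HasSingularFibre (A B : MvPolynomial (Fin 2) k) : Prop :=
  ∃ x y : k, (x ≠ 0 ∨ y ≠ 0) ∧ eval ![x, y] A = 0 ∧ ∀ i, eval ![x, y] (singForm i A B) = 0

theorem exists_eval_ne_zero_of_ne_zero [Infinite k] (hA : A.IsHomogeneous m) (h : A ≠ 0) :
    ∃ x : k, eval ![x, 1] A ≠ 0 := by
  by_contra! hx
  refine h ?_
  rw [← homogenize_dehomogenize hA]
  have : dehomogenize A = 0 := Polynomial.funext fun x => by
    rw [eval_dehomogenize, hx, Polynomial.eval_zero]
  rw [this, Polynomial.homogenize_zero]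

/-- The substitution `X ↦ x X + Y`, `Y ↦ X`. -/
noncomputable def moveGL (x : k) : GL (Fin 2) k :=
  Matrix.GeneralLinearGroup.mkOfDetNeZero !![x, 1; 1, 0] (by simp [Matrix.det_fin_two])

theorem moveGL_coe (x : k) : (moveGL x : Matrix (Fin 2) (Fin 2) k) = !![x, 1; 1, 0] := rfl

/-- The pair (S₀, S₁) is transformed into (x² S₀ + S₁, S₀), an invertible combination, so common
zeros correspond. -/
theorem hasSingularFibre_substForm_moveGL [CharP k 2] (x : k) :
    HasSingularFibre (substForm (moveGL x) A) (substForm (moveGL x) B) ↔ HasSingularFibre A B := by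
  have key : ∀ p q : k, ((eval ![p, q] (substForm (moveGL x) A) = 0 ∧ ∀ i, eval ![p, q]
      (singForm i (substForm (moveGL x) A) (substForm (moveGL x) B)) = 0) ↔
      (eval ![x * p + q, p] A = 0 ∧ ∀ i, eval ![x * p + q, p] (singForm i A B) = 0)) := by
    intro p q
    have e : ∀ F, eval ![p, q] (substForm (moveGL x) F) = eval ![x * p + q, p] F := fun F => by
      rw [eval_substForm, moveGL_coe]
      simp
    have e0 : eval ![p, q] (singForm 0 (substForm (moveGL x) A) (substForm (moveGL x) B)) =
        x ^ 2 * eval ![x * p + q, p] (singForm 0 A B) + eval ![x * p + q, p] (singForm 1 A B) := by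
      rw [singForm_substForm, map_add, map_mul, map_mul, e, e, moveGL_coe]
      simp
    have e1 : eval ![p, q] (singForm 1 (substForm (moveGL x) A) (substForm (moveGL x) B)) =
        eval ![x * p + q, p] (singForm 0 A B) := by
      rw [singForm_substForm, map_add, map_mul, map_mul, e, e, moveGL_coe]
      simp
    rw [Fin.forall_fin_two, Fin.forall_fin_two, e, e0, e1]
    refine and_congr_right fun _ => ⟨fun ⟨h1, h2⟩ => ⟨h2, ?_⟩, fun ⟨h1, h2⟩ => ⟨?_, h1⟩⟩
    · linear_combination h1 - x ^ 2 * h2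
    · linear_combination x ^ 2 * h1 + h2
  constructor
  · rintro ⟨p, q, hpq, h⟩
    refine ⟨x * p + q, p, ?_, (key p q).mp h⟩
    by_contra! h0
    have hq := h0.1
    rw [h0.2, mul_zero, zero_add] at hq
    tauto
  · rintro ⟨p, q, hpq, h⟩
    refine ⟨q, p - x * q, ?_, (key q (p - x * q)).mpr ?_⟩
    · by_contra! h0
      have hp := h0.2
      rw [h0.1, mul_zero, sub_zero] at hp
      tauto
    · rwa [add_sub_cancel]

/-- Euler's relation X B_X + Y B_Y = 2m B = 0 forces B_X = Y G and B_Y = X G. For A = 0 the points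
with singular fibre are thus the zeros of G, of degree 2m - 2. -/
theorem exists_pderiv_eq_linForm_mul [CharP k 2] (hm : 1 ≤ m) (hB : B.IsHomogeneous (2 * m)) :
    ∃ G : MvPolynomial (Fin 2) k, G.IsHomogeneous (2 * m - 2) ∧ pderiv 0 B = X 1 * G ∧
      pderiv 1 B = X 0 * G := by
  have h0 : (pderiv 0 B).IsHomogeneous (2 * m - 2 + 1) := by
    rw [show 2 * m - 2 + 1 = 2 * m - 1 by omega]; exact hB.pderiv
  have he := eval_euler hB ![1, 0]
  rw [Nat.cast_mul, show ((2 : ℕ) : k) = 0 from CharP.cast_eq_zero k 2] at he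
  obtain ⟨G, hG, h⟩ := exists_eq_linForm_mul h0 (x := 1) (y := 0) (by simp) (by simpa using he)
  have hl : (linForm 0 1 : MvPolynomial (Fin 2) k) = X 1 := by simp [linForm]
  rw [hl] at h
  refine ⟨G, hG, h, ?_⟩
  have h2 := hB.sum_X_mul_pderiv
  have h3 : ((2 * m : ℕ) : MvPolynomial (Fin 2) k) = 0 := by
    rw [Nat.cast_mul, show ((2 : ℕ) : MvPolynomial (Fin 2) k) = 0 from CharP.cast_eq_zero _ 2,
      zero_mul]
  rw [Fin.sum_univ_two, nsmul_eq_mul, h3, zero_mul, h, CharTwo.add_eq_zero] at h2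
  refine mul_left_cancel₀ (X_ne_zero (R := k) (1 : Fin 2)) ?_
  rw [← h2]; ring

variable [IsAlgClosed k] [CharP k 2] {Δ : MvPolynomial (CoeffIndex m) k}

/-- Some factor S₀(bᵢ, aᵢ) vanishes, and as aᵢ ≠ 0 the relation b² S₀ = a² S₁ makes S₁ vanish there
too. Conversely, every zero of A is proportional to some (bᵢ, aᵢ). -/
theorem IsDelta.evalPair_eq_zero_iff_of_eval_ne_zero (h : IsDelta m Δ) (hm : 1 ≤ m)
    (hA : A.IsHomogeneous m) (hB : B.IsHomogeneous (2 * m)) (h0 : eval ![1, 0] A ≠ 0) :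
    evalPair m Δ A B = 0 ↔ HasSingularFibre A B := by
  obtain ⟨a, b, hab, ha⟩ := exists_eq_prod_linForm_of_eval_ne_zero hm hA h0
  have n1 := pow_ne_zero 2 (Finset.prod_ne_zero_iff.mpr fun i (_ : i ∈ Finset.univ) => ha i)
  have e := h.prod_eval hm ha hA hB hab
  have hr : ∀ i, eval ![b i, a i] A = 0 := fun i => by rw [hab]; exact eval_prod_linForm_root a b i
  constructor
  · intro h1
    rw [h1, mul_zero] at e
    obtain ⟨i, -, hi⟩ := Finset.prod_eq_zero_iff.mp e.symm
    refine ⟨b i, a i, Or.inr (ha i), hr i, Fin.forall_fin_two.mpr ⟨hi, ?_⟩⟩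
    have := sq_mul_eval_singForm hA hB (hr i)
    rw [hi, mul_zero] at this
    simpa [ha i] using this.symm
  · rintro ⟨x, y, hxy, hp, hs⟩
    rw [hab, map_prod] at hp
    obtain ⟨i, -, hi⟩ := Finset.prod_eq_zero_iff.mp hp
    rw [eval_linForm] at hi
    simp only [Matrix.cons_val_zero, Matrix.cons_val_one, Matrix.cons_val_fin_one] at hi
    have hy : y ≠ 0 := by
      rintro rfl
      rw [mul_zero, add_zero, mul_eq_zero] at hi
      have := ha i
      tauto
    have hb : b i = a i / y * x := by
      field_simp
      rw [CharTwo.add_eq_zero] at hi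
      exact hi.symm
    refine (mul_eq_zero.mp (e.trans ?_)).resolve_left n1
    refine Finset.prod_eq_zero (Finset.mem_univ i) ?_
    have ha' : a i = a i / y * y := by field_simp
    rw [hb, show ![a i / y * x, a i] = ![a i / y * x, a i / y * y] by rw [← ha'],
      eval_smul_of_isHomogeneous (singForm_isHomogeneous hm hA hB 0), hs 0, mul_zero]

/-- A linear change of variables carries (1, 0) to a point (x, 1) where A does not vanish, and both
sides are invariant. -/
theorem IsDelta.evalPair_eq_zero_iff_of_ne_zero (h : IsDelta m Δ) (hm : 1 ≤ m)
    (hA : A.IsHomogeneous m) (hB : B.IsHomogeneous (2 * m)) (h0 : A ≠ 0) :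
    evalPair m Δ A B = 0 ↔ HasSingularFibre A B := by
  have := IsAlgClosed.instInfinite (K := k)
  obtain ⟨x, hx⟩ := exists_eval_ne_zero_of_ne_zero hA h0
  rw [← hasSingularFibre_substForm_moveGL x,
    ← h.evalPair_eq_zero_iff_of_eval_ne_zero hm (substForm_isHomogeneous _ hA)
      (substForm_isHomogeneous _ hB), h.evalPair_substForm hm _ hA hB, mul_eq_zero, or_iff_right]
  · exact pow_ne_zero _ (Matrix.isUnits_det_units (moveGL x)).ne_zero
  · rw [eval_substForm, moveGL_coe]
    simpa using hx

/-- For A = 0 the defining identities read 0 = 0, so Δ(0, B) is found by letting t tend to 0 in Δ(t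
A₁, B). For m = 1 and A₁ = X this is t² b₂ + g², with g the constant value of G. For m ≥ 2 both
sides are always true. -/
theorem IsDelta.evalPair_zero_eq_zero_iff (h : IsDelta m Δ) (hm : 1 ≤ m)
    (hB : B.IsHomogeneous (2 * m)) :
    evalPair m Δ 0 B = 0 ↔ HasSingularFibre 0 B := by
  have := IsAlgClosed.instInfinite (K := k)
  obtain ⟨G, hG, hG0, hG1⟩ := exists_pderiv_eq_linForm_mul hm hB
  rcases Nat.eq_or_lt_of_le hm with rfl | hm2
  · rw [← totalDegree_zero_iff_isHomogeneous, totalDegree_eq_zero_iff_eq_C] at hG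
    have hs : HasSingularFibre 0 B ↔ coeff 0 G = 0 := by
      constructor
      · rintro ⟨x, y, hxy, -, hs⟩
        have h0 := hs 0
        have h1 := hs 1
        rw [singForm, hG0, hG] at h0
        rw [singForm, hG1, hG] at h1
        simp at h0 h1
        tauto
      · intro hc
        refine ⟨1, 0, by simp, by simp, fun i => ?_⟩
        rw [hc, C_0] at hG
        fin_cases i <;> simp [singForm, hG0, hG1, hG]
    obtain ⟨p, hp⟩ := exists_evalPair_line_eq Δ 0 B (X 0) 0
    have hpq : p - (Polynomial.C (eval ![0, 1] B) * Polynomial.X ^ 2 +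
        Polynomial.C (coeff 0 G ^ 2)) = 0 := by
      refine eq_zero_of_forall_eval_ne_zero Polynomial.X_ne_zero fun t ht => ?_
      rw [Polynomial.eval_X] at ht
      have hAt : (C t * X 0 : MvPolynomial (Fin 2) k).IsHomogeneous 1 := isHomogeneous_C_mul_X _ _
      have e := h.prod_eval le_rfl (a := fun _ => t) (b := fun _ => 0) (fun _ => ht) hAt hB
        (by simp [linForm])
      rw [singForm, hG0, hG] at e
      have hB1 : eval ![0, t] B = t ^ 2 * eval ![0, 1] B := by
        have := eval_smul_of_isHomogeneous hB t 0 1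
        simpa using this
      simp [hB1] at e
      have hval : evalPair 1 Δ (C t * X 0) B = t ^ 2 * eval ![0, 1] B + coeff 0 G ^ 2 := by
        refine mul_left_cancel₀ (pow_ne_zero 2 ht) (e.trans ?_)
        ring
      rw [Polynomial.eval_sub, hp, zero_add, mul_zero, add_zero, hval]
      simp only [Polynomial.eval_add, Polynomial.eval_mul, Polynomial.eval_C, Polynomial.eval_pow,
        Polynomial.eval_X]
      ring
    have h1 := hp 0
    rw [sub_eq_zero.mp hpq] at h1
    simp only [C_0, zero_mul, add_zero] at h1
    rw [← h1, hs]
    simp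
  · obtain ⟨n, hn⟩ : ∃ n, 2 * m - 2 = n + 1 := ⟨2 * m - 3, by omega⟩
    rw [hn] at hG
    obtain ⟨x, y, hxy, hxyG⟩ := exists_zero_of_isHomogeneous hG
    have hp0 : ∀ i, eval ![x, y] (pderiv i B) = 0 := by
      refine Fin.forall_fin_two.mpr ⟨?_, ?_⟩
      · rw [hG0, map_mul, hxyG, mul_zero]
      · rw [hG1, map_mul, hxyG, mul_zero]
    have hroot : eval ![x, y] (linForm y x) = 0 := by
      simp [mul_comm, CharTwo.add_self_eq_zero]
    -- Since m ≥ 2, the form ℓᵐ has a multiple zero at the chosen zero of G, so (t ℓᵐ, B) has a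
    -- singular fibre there for every t.
    obtain ⟨p, hp⟩ := exists_evalPair_line_eq Δ 0 B (linForm y x ^ m) 0
    have hl := (linForm_isHomogeneous y x).pow m
    rw [one_mul] at hl
    have hp' : p = 0 := by
      refine eq_zero_of_forall_eval_ne_zero Polynomial.X_ne_zero fun t ht => ?_
      rw [Polynomial.eval_X] at ht
      rw [hp, zero_add, mul_zero, add_zero, h.evalPair_eq_zero_iff_of_ne_zero hm (hl.C_mul t) hB]
      · refine ⟨x, y, hxy, ?_, fun i => ?_⟩
        · rw [map_mul, map_pow, hroot, zero_pow (by omega), mul_zero]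
        · rw [singForm, pderiv_C_mul, pderiv_pow]
          simp only [map_add, map_mul, map_pow, hp0, hroot]
          rw [zero_pow (by omega : m - 1 ≠ 0)]
          simp
      · exact mul_ne_zero (by simpa using ht) (pow_ne_zero _ (linForm_ne_zero (by tauto)))
    have h1 := hp 0
    rw [hp'] at h1
    simp only [C_0, zero_mul, add_zero, Polynomial.eval_zero] at h1
    refine iff_of_true h1.symm ⟨x, y, hxy, map_zero _, fun i => ?_⟩
    simp [singForm, hp0]

theorem IsDelta.evalPair_eq_zero_iff (h : IsDelta m Δ) (hm : 1 ≤ m)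
    (hA : A.IsHomogeneous m) (hB : B.IsHomogeneous (2 * m)) :
    evalPair m Δ A B = 0 ↔ HasSingularFibre A B := by
  by_cases h0 : A = 0
  · subst h0
    exact h.evalPair_zero_eq_zero_iff hm hB
  · exact h.evalPair_eq_zero_iff_of_ne_zero hm hA hB h0

/-- At a zero of ℓ both A and the first derivatives and value of ℓ² B' vanish. The case ℓ = 0 is
allowed, so that the parameters (a, b, A', B', α) range over a whole affine space. -/
theorem IsDelta.evalPair_linForm_mul_eq_zero (h : IsDelta m Δ) (hm : 1 ≤ m) (a b : k)
    {A' B' α : MvPolynomial (Fin 2) k} (hA : (linForm a b * A').IsHomogeneous m)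
    (hB : (linForm a b ^ 2 * B').IsHomogeneous (2 * m)) (hα : α.IsHomogeneous m) :
    evalPair m Δ (linForm a b * A')
      (linForm a b ^ 2 * B' + α * (linForm a b * A') + α ^ 2) = 0 := by
  rw [h.evalPair_add_mul_add_sq hm hA hB hα, h.evalPair_eq_zero_iff hm hA hB]
  obtain ⟨x, y, hxy, hp⟩ : ∃ x y : k, (x ≠ 0 ∨ y ≠ 0) ∧ eval ![x, y] (linForm a b) = 0 := by
    by_cases hab : b ≠ 0 ∨ a ≠ 0
    · exact ⟨b, a, hab, by simp [mul_comm, CharTwo.add_self_eq_zero]⟩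
    · push Not at hab
      exact ⟨1, 0, by simp, by simp [hab.1, hab.2]⟩
  refine ⟨x, y, hxy, by rw [map_mul, hp, zero_mul], fun i => ?_⟩
  simp [singForm, hp]

/-- Choose α with α(p)² = B(p) at the singular point p. Then B + α A + α² vanishes at p. Its S-forms
still vanish there, as they changed by a multiple of A, so its first derivatives vanish too and ℓ²
divides it. -/
theorem HasSingularFibre.exists_linForm (h : HasSingularFibre A B) (hm : 1 ≤ m)
    (hA : A.IsHomogeneous m) (hB : B.IsHomogeneous (2 * m)) :
    ∃ (a b : k) (A' B' α : MvPolynomial (Fin 2) k), (a ≠ 0 ∨ b ≠ 0) ∧ A'.IsHomogeneous (m - 1) ∧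
      B'.IsHomogeneous (2 * m - 2) ∧ α.IsHomogeneous m ∧ A = linForm a b * A' ∧
      B = linForm a b ^ 2 * B' + α * A + α ^ 2 := by
  obtain ⟨x, y, hxy, hp, hs⟩ := h
  obtain ⟨M, hM, -, hMp⟩ := exists_isHomogeneous_eval_ne_zero m hxy
  obtain ⟨c, hc⟩ := IsAlgClosed.exists_pow_nat_eq (eval ![x, y] B) (n := 2) two_pos
  have hα := hM.C_mul (c / eval ![x, y] M)
  set α := C (c / eval ![x, y] M) * M with hαdef
  have hαp : eval ![x, y] α ^ 2 = eval ![x, y] B := by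
    rw [hαdef, map_mul, eval_C, div_mul_cancel₀ _ hMp, hc]
  have hB1 : (B + α * A + α ^ 2).IsHomogeneous (2 * m) :=
    (hB.add (by rw [two_mul]; exact hα.mul hA)).add (by rw [mul_comm]; exact hα.pow 2)
  have hB1p : eval ![x, y] (B + α * A + α ^ 2) = 0 := by
    rw [map_add, map_add, map_mul, map_pow, hαp, hp, mul_zero, add_zero, CharTwo.add_self_eq_zero]
  have hd : ∀ i, eval ![x, y] (pderiv i (B + α * A + α ^ 2)) = 0 := by
    intro i
    have h1 := congrArg (eval ![x, y]) (singForm_add_mul_add_sq i A B α)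
    rw [map_add, map_mul, hp, zero_mul, add_zero, hs, singForm, map_add, map_mul, hB1p, mul_zero,
      zero_add, map_pow] at h1
    exact pow_eq_zero_iff two_ne_zero |>.mp h1
  have hA' : A.IsHomogeneous (m - 1 + 1) := by rwa [Nat.sub_add_cancel hm]
  have hB1' : (B + α * A + α ^ 2).IsHomogeneous (2 * m - 2 + 1 + 1) := by
    rwa [show 2 * m - 2 + 1 + 1 = 2 * m by omega]
  obtain ⟨A', hA'h, hA'e⟩ := exists_eq_linForm_mul hA' hxy hp
  obtain ⟨G, hG, hGe⟩ := exists_eq_linForm_mul hB1' hxy hB1p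
  have hroot : eval ![x, y] (linForm y x) = 0 := by
    simp [mul_comm, CharTwo.add_self_eq_zero]
  -- At p the gradient of ℓ G is G(p) times that of ℓ, which is nonzero.
  have hGp : eval ![x, y] G = 0 := by
    have h0 := hd 0
    have h1 := hd 1
    rw [hGe, pderiv_mul, map_add, map_mul, map_mul, hroot, zero_mul, add_zero] at h0 h1
    simp [linForm, pderiv_X] at h0 h1
    tauto
  obtain ⟨B', hB', hB'e⟩ := exists_eq_linForm_mul hG hxy hGp
  refine ⟨y, x, A', B', α, by tauto, hA'h, hB', hα, hA'e, ?_⟩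
  rw [pow_two, mul_assoc, ← hB'e, ← hGe]
  have h2 : (2 : MvPolynomial (Fin 2) k) = 0 := CharTwo.two_eq_zero
  linear_combination (-(α * A) - α ^ 2) * h2

/-- The normal form places a zero of Δ in the orbit of Z unless A or ℓ² B' is zero. Adding t ℓᵐ and
t ℓ²ᵐ repairs this for all but finitely many t, so any polynomial vanishing on the orbit vanishes at
t = 0. -/
theorem IsDelta.zeroLocus_eq (h : IsDelta m Δ) (hm : 1 ≤ m) :
    {p | eval p Δ = 0} = zariskiClosure (orbitZ k m) := by
  have := IsAlgClosed.instInfinite (K := k)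
  ext p
  rw [Set.mem_ofPred_eq, zariskiClosure, mem_zeroLocus_iff]
  constructor
  · intro hp f hf
    rw [mem_vanishingIdeal_iff] at hf
    rw [← evalPair_binaryForm] at hp
    have hA := binaryForm_isHomogeneous m (fun i => p (Sum.inl i))
    have hB := binaryForm_isHomogeneous (2 * m) (fun i => p (Sum.inr i))
    have hpc := pairCoeff_binaryForm p
    rw [h.evalPair_eq_zero_iff hm hA hB] at hp
    generalize binaryForm m (fun i => p (Sum.inl i)) = A at *
    generalize binaryForm (2 * m) (fun i => p (Sum.inr i)) = B at *
    obtain ⟨a, b, A', B', α, hab, hA', hB', hα, hAe, hBe⟩ := hp.exists_linForm hm hA hB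
    obtain ⟨v, hv⟩ : ∃ v : Fin 2 → k, eval v (linForm a b) ≠ 0 := by
      rcases hab with ha | hb
      · exact ⟨![1, 0], by simpa using ha⟩
      · exact ⟨![0, 1], by simpa using hb⟩
    have hl := linForm_isHomogeneous a b
    have hlm := hl.pow m
    have hl2m := hl.pow (2 * m)
    rw [one_mul] at hlm hl2m
    have hB1 : (linForm a b ^ 2 * B').IsHomogeneous (2 * m) := by
      have := (hl.pow 2).mul hB'
      rwa [show 1 * 2 + (2 * m - 2) = 2 * m by omega] at this
    -- The term α ℓᵐ compensates the change of A in α A, so the moving point remains a translate by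
    -- the same α.
    obtain ⟨q, hq⟩ := exists_evalPair_line_eq f A B (linForm a b ^ m)
      (linForm a b ^ (2 * m) + α * linForm a b ^ m)
    have hq0 : q = 0 := by
      refine eq_zero_of_forall_eval_ne_zero (mul_ne_zero
        (C_add_C_mul_X_ne_zero (eval v A) (pow_ne_zero m hv))
        (C_add_C_mul_X_ne_zero (eval v (linForm a b ^ 2 * B')) (pow_ne_zero (2 * m) hv)))
        fun t ht => ?_
      rw [Polynomial.eval_mul] at ht
      rw [hq]
      refine hf _ ⟨A + C t * linForm a b ^ m, linForm a b ^ 2 * B' + C t * linForm a b ^ (2 * m),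
        α, ⟨hA.add (hlm.C_mul t), hB1.add (hl2m.C_mul t), ?_, ?_, linForm a b, hl,
          linForm_ne_zero hab, ?_, ?_⟩, hα, ?_⟩
      · intro h0
        refine left_ne_zero_of_mul ht ?_
        have := congrArg (eval v) h0
        rw [map_add, map_mul, eval_C, map_pow, mul_comm t] at this
        simpa using this
      · intro h0
        refine right_ne_zero_of_mul ht ?_
        have := congrArg (eval v) h0
        rw [map_add, map_mul (eval v) (C t), eval_C, map_pow _ _ (2 * m), mul_comm t] at this
        simpa using this
      · rw [hAe]
        exact (Dvd.intro _ rfl).add (dvd_mul_of_dvd_right (dvd_pow_self _ (by omega)) _)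
      · exact (Dvd.intro _ rfl).add (dvd_mul_of_dvd_right (pow_dvd_pow _ (by omega)) _)
      · congr 1
        rw [hBe]; ring
    have h1 := hq 0
    rw [hq0] at h1
    simp only [C_0, zero_mul, add_zero, Polynomial.eval_zero] at h1
    rw [← hpc]
    exact h1.symm
  · intro hp
    refine hp Δ ?_
    rw [mem_vanishingIdeal_iff]
    rintro _ ⟨A, B, α, ⟨hA, hB, -, -, l, hl, hl0, ⟨A', rfl⟩, ⟨B', rfl⟩⟩, hα, rfl⟩
    have hlin : l = linForm (formCoeff 1 l 0) (formCoeff 1 l 1) := by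
      conv_lhs => rw [← binaryForm_formCoeff hl]
      simp [binaryForm, linForm, Fin.sum_univ_two]
    rw [hlin] at hA hB ⊢
    exact h.evalPair_linForm_mul_eq_zero hm _ _ hA hB hα

end ZeroLocus

end HyperellipticCurve

namespace HyperellipticCurve

open MvPolynomial

/-! ### Irreducibility of `Δ` -/

section Irreducible

variable {k : Type*} [Field k] {m : ℕ}

/-- The line through two forms `F`, `G`, as a form over `k[t]`. -/
noncomputable def lineForm (F G : MvPolynomial (Fin 2) k) : MvPolynomial (Fin 2) (Polynomial k) :=
  map Polynomial.C F + C Polynomial.X * map Polynomial.C (G - F)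

theorem map_lineForm (F G : MvPolynomial (Fin 2) k) (t : k) :
    map (Polynomial.evalRingHom t) (lineForm F G) = F + C t * (G - F) := by
  have h : (Polynomial.evalRingHom t).comp Polynomial.C = RingHom.id k := by ext; simp
  rw [lineForm, map_add, map_mul, map_map, map_map, map_C, h, map_id, map_id]
  simp

theorem pairCoeff_map_evalRingHom (F G : MvPolynomial (Fin 2) (Polynomial k)) (t : k) :
    (fun i => ((Sum.elim (formCoeff m F) (formCoeff (2 * m) G) : CoeffIndex m → _) i).eval t) =
      pairCoeff m (map (Polynomial.evalRingHom t) F) (map (Polynomial.evalRingHom t) G) := by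
  ext (i | i) <;> simp [pairCoeff, formCoeff_map]

theorem isHomogeneous_lerp {n : ℕ} {F G : MvPolynomial (Fin 2) k} (hF : F.IsHomogeneous n)
    (hG : G.IsHomogeneous n) (t : k) : (F + C t * (G - F)).IsHomogeneous n :=
  hF.add ((hG.sub hF).C_mul t)

variable [IsAlgClosed k] [CharP k 2] {Δ : MvPolynomial (CoeffIndex m) k}

theorem IsDelta.exists_linForm (h : IsDelta m Δ) (hm : 1 ≤ m) {p : CoeffIndex m → k}
    (hp : eval p Δ = 0) :
    ∃ (a b : k) (A' B' α : MvPolynomial (Fin 2) k), A'.IsHomogeneous (m - 1) ∧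
      B'.IsHomogeneous (2 * m - 2) ∧ α.IsHomogeneous m ∧
      p = pairCoeff m (linForm a b * A')
        (linForm a b ^ 2 * B' + α * (linForm a b * A') + α ^ 2) := by
  rw [← evalPair_binaryForm, h.evalPair_eq_zero_iff hm (binaryForm_isHomogeneous _ _)
    (binaryForm_isHomogeneous _ _)] at hp
  obtain ⟨a, b, A', B', α, -, hA', hB', hα, hA, hB⟩ :=
    hp.exists_linForm hm (binaryForm_isHomogeneous _ _) (binaryForm_isHomogeneous _ _)
  refine ⟨a, b, A', B', α, hA', hB', hα, ?_⟩
  rw [← hA, ← hB, pairCoeff_binaryForm]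

/-- The zero set is the image of the affine space of parameters (a, b, A', B', α). Join the
parameters of two zeros p, q by a line: the pullback of f g to k[t] vanishes, so f or g vanishes
along the line, contradicting f(p) ≠ 0 or g(q) ≠ 0. -/
theorem IsDelta.forall_eval_eq_zero_or (h : IsDelta m Δ) (hm : 1 ≤ m)
    {f g : MvPolynomial (CoeffIndex m) k} (hfg : ∀ p, eval p Δ = 0 → eval p (f * g) = 0) :
    (∀ p, eval p Δ = 0 → eval p f = 0) ∨ (∀ p, eval p Δ = 0 → eval p g = 0) := by
  have := IsAlgClosed.instInfinite (K := k)
  by_contra! hc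
  obtain ⟨⟨p, hp, hpf⟩, q, hq, hqg⟩ := hc
  obtain ⟨a, b, A, B, α, hA, hB, hα, rfl⟩ := h.exists_linForm hm hp
  obtain ⟨a', b', A', B', α', hA', hB', hα', rfl⟩ := h.exists_linForm hm hq
  set L := lineForm (linForm a b) (linForm a' b')
  set F := L * lineForm A A' with hF
  set G := L ^ 2 * lineForm B B' + lineForm α α' * F + lineForm α α' ^ 2 with hG
  set c : CoeffIndex m → Polynomial k := Sum.elim (formCoeff m F) (formCoeff (2 * m) G) with hc
  have hlin : ∀ t : k, linForm a b + C t * (linForm a' b' - linForm a b) =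
      linForm (a + t * (a' - a)) (b + t * (b' - b)) := by
    intro t
    simp only [linForm, C_add, C_mul, C_sub]; ring
  have hct : ∀ t, (fun i => (c i).eval t) = pairCoeff m
      ((linForm a b + C t * (linForm a' b' - linForm a b)) * (A + C t * (A' - A)))
      ((linForm a b + C t * (linForm a' b' - linForm a b)) ^ 2 * (B + C t * (B' - B)) +
        (α + C t * (α' - α)) * ((linForm a b + C t * (linForm a' b' - linForm a b)) *
          (A + C t * (A' - A))) + (α + C t * (α' - α)) ^ 2) := by
    intro t
    rw [hc, pairCoeff_map_evalRingHom]
    simp only [hG, hF, map_add, map_mul, map_pow, map_lineForm, L]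
  have hΔ : ∀ t, eval (fun i => (c i).eval t) Δ = 0 := by
    intro t
    rw [hct, hlin]
    refine h.evalPair_linForm_mul_eq_zero hm _ _ ?_ ?_ (isHomogeneous_lerp hα hα' t)
    · have := (linForm_isHomogeneous (a + t * (a' - a)) (b + t * (b' - b))).mul
        (isHomogeneous_lerp hA hA' t)
      rwa [Nat.add_sub_cancel' hm] at this
    · have := ((linForm_isHomogeneous (a + t * (a' - a)) (b + t * (b' - b))).pow 2).mul
        (isHomogeneous_lerp hB hB' t)
      rwa [show 1 * 2 + (2 * m - 2) = 2 * m by omega] at this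
  have hz : aeval c f * aeval c g = 0 := by
    rw [← map_mul]
    refine Polynomial.funext fun t => ?_
    rw [eval_aeval_path, hfg _ (hΔ t), Polynomial.eval_zero]
  rcases mul_eq_zero.mp hz with hz | hz
  · have := congrArg (Polynomial.eval 0) hz
    rw [eval_aeval_path, hct] at this
    simp only [C_0, zero_mul, add_zero, Polynomial.eval_zero] at this
    exact hpf this
  · have := congrArg (Polynomial.eval 1) hz
    rw [eval_aeval_path, hct] at this
    simp only [C_1, one_mul, add_sub_cancel, Polynomial.eval_zero] at this
    exact hqg this

/-- On a suitable line, `Δ` has only simple zeros. -/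
theorem IsDelta.exists_separable_line (h : IsDelta m Δ) (hm : 1 ≤ m) :
    ∃ c : CoeffIndex m → Polynomial k, (aeval c Δ).Separable ∧ ∃ t, (aeval c Δ).IsRoot t := by
  have := IsAlgClosed.instInfinite (K := k)
  obtain ⟨r, hr⟩ : ∃ r : Fin m → k, Function.Injective r :=
    ⟨fun i => Infinite.natEmbedding k i, fun i j hij => by
      exact Fin.ext ((Infinite.natEmbedding k).injective hij)⟩
  set A : MvPolynomial (Fin 2) k := ∏ i, linForm 1 (r i) with hAdef
  have hA : A.IsHomogeneous m := by
    have := IsHomogeneous.prod Finset.univ (fun i => linForm 1 (r i)) (fun _ => 1)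
      fun i _ => linForm_isHomogeneous 1 (r i)
    simpa using this
  -- Both B₀ and B₁ have zero X-derivative in characteristic two, so S₀ = A_X² (B₀ + t B₁), whose
  -- value at the root (rᵢ, 1) is A_X(rᵢ, 1)² (rᵢ² + t). Thus Δ is a nonzero constant times ∏ (t -
  -- rᵢ²).
  set B₀ : MvPolynomial (Fin 2) k := X 0 ^ 2 * X 1 ^ (2 * m - 2)
  set B₁ : MvPolynomial (Fin 2) k := X 1 ^ (2 * m)
  have hB₀ : B₀.IsHomogeneous (2 * m) := by
    have := (isHomogeneous_X_pow (R := k) (0 : Fin 2) 2).mul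
      (isHomogeneous_X_pow (R := k) (1 : Fin 2) (2 * m - 2))
    rwa [show 2 + (2 * m - 2) = 2 * m by omega] at this
  have hB₁ : B₁.IsHomogeneous (2 * m) := isHomogeneous_X_pow _ _
  set c : CoeffIndex m → Polynomial k := fun i => Polynomial.C (pairCoeff m A B₀ i) +
    Polynomial.C (pairCoeff m 0 B₁ i) * Polynomial.X with hc
  have hct : ∀ t, (fun i => (c i).eval t) = pairCoeff m A (B₀ + C t * B₁) := by
    intro t
    have := pairCoeff_add_C_mul (m := m) A B₀ 0 B₁ t
    rw [mul_zero, add_zero] at this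
    rw [this]
    ext i
    simp only [hc, Polynomial.eval_add, Polynomial.eval_mul, Polynomial.eval_C, Polynomial.eval_X,
      Pi.add_apply, Pi.smul_apply, smul_eq_mul, mul_comm t]
  have hderiv : ∀ i, eval ![r i, 1] (pderiv 0 A) ≠ 0 := by
    intro i
    have e : A = linForm 1 (r i) * ∏ j ∈ Finset.univ.erase i, linForm 1 (r j) :=
      (Finset.mul_prod_erase _ _ (Finset.mem_univ i)).symm
    rw [e, pderiv_mul]
    have e2 : pderiv 0 (linForm 1 (r i)) = 1 := by simp [linForm, pderiv_X]
    have e3 : eval ![r i, 1] (linForm 1 (r i)) = 0 := by simp [CharTwo.add_self_eq_zero]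
    rw [e2, map_add, map_mul, map_mul, e3, zero_mul, add_zero, map_one, one_mul, map_prod]
    refine Finset.prod_ne_zero_iff.mpr fun j hj => ?_
    simp only [eval_linForm, Matrix.cons_val_zero, Matrix.cons_val_one, Matrix.cons_val_fin_one,
      one_mul, mul_one]
    rw [Ne, CharTwo.add_eq_zero]
    exact fun hij => (Finset.ne_of_mem_erase hj) (hr hij).symm
  have hval : aeval c Δ = Polynomial.C (∏ i, eval ![r i, 1] (pderiv 0 A) ^ 2) *
      ∏ i, (Polynomial.X - Polynomial.C (r i ^ 2)) := by
    refine Polynomial.funext fun t => ?_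
    have e := h.prod_eval hm (a := fun _ => 1) (b := r) (fun _ => one_ne_zero) hA
      (hB₀.add (hB₁.C_mul t)) hAdef
    rw [Finset.prod_const_one, one_pow, one_mul] at e
    rw [eval_aeval_path, hct, ← evalPair, e, Polynomial.eval_mul, Polynomial.eval_C,
      Polynomial.eval_prod, ← Finset.prod_mul_distrib]
    refine Finset.prod_congr rfl fun i _ => ?_
    have e2 : pderiv 0 (B₀ + C t * B₁) = 0 := by
      simp [B₀, B₁, pderiv_X, CharTwo.two_eq_zero]
    rw [singForm, e2]
    simp only [B₀, B₁, CharTwo.sub_eq_add]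
    simp [add_comm]
  refine ⟨c, ?_, r ⟨0, hm⟩ ^ 2, ?_⟩
  · rw [hval]
    refine Polynomial.Separable.unit_mul (Polynomial.isUnit_C.mpr (isUnit_iff_ne_zero.mpr
      (Finset.prod_ne_zero_iff.mpr fun i _ => pow_ne_zero 2 (hderiv i)))) ?_
    exact Polynomial.separable_prod_X_sub_C_iff.mpr fun i j hij => hr (CharTwo.sq_injective hij)
  · have h0 : ∏ i, ((Polynomial.X - Polynomial.C (r i ^ 2)).eval (r ⟨0, hm⟩ ^ 2)) = 0 :=
      Finset.prod_eq_zero (Finset.mem_univ ⟨0, hm⟩) (by simp)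
    rw [hval, Polynomial.IsRoot, Polynomial.eval_mul, Polynomial.eval_prod, h0, mul_zero]

/-- Some prime factor P of Δ vanishes on all of {Δ = 0}. A further prime factor P' would, by the
Nullstellensatz, divide P and so be associated to it, giving P² ∣ Δ. But on the separable line P has
a root, so its square cannot divide the restriction of Δ. -/
theorem IsDelta.irreducible (h : IsDelta m Δ) (hm : 1 ≤ m) : Irreducible Δ := by
  obtain ⟨c, hsep, t, ht⟩ := h.exists_separable_line hm
  have hΔ0 : Δ ≠ 0 := by
    rintro rfl
    rw [map_zero] at hsep
    exact hsep.ne_zero rfl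
  have hpt : eval (fun i => (c i).eval t) Δ = 0 := by rw [← eval_aeval_path]; exact ht
  have hmul : ∀ s : Multiset (MvPolynomial (CoeffIndex m) k),
      (∀ p, eval p Δ = 0 → eval p s.prod = 0) → ∃ f ∈ s, ∀ p, eval p Δ = 0 → eval p f = 0 := by
    intro s
    induction s using Multiset.induction_on with
    | empty =>
      intro hs
      -- An empty product would give 1 = 0 at the known zero of Δ.
      simpa using hs _ hpt
    | cons a s ih =>
      intro hs
      rw [Multiset.prod_cons] at hs
      rcases h.forall_eval_eq_zero_or hm hs with h1 | h1
      · exact ⟨a, Multiset.mem_cons_self _ _, h1⟩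
      · obtain ⟨f, hf, hf'⟩ := ih h1
        exact ⟨f, Multiset.mem_cons_of_mem hf, hf'⟩
  obtain ⟨P, hP, hPV⟩ := hmul (UniqueFactorizationMonoid.factors Δ) fun p hp => by
    obtain ⟨u, hu⟩ := (UniqueFactorizationMonoid.factors_prod hΔ0).symm
    rw [← hu, map_mul, hp, zero_mul]
  have hPp := UniqueFactorizationMonoid.prime_of_factor P hP
  obtain ⟨Q, hQ⟩ := UniqueFactorizationMonoid.dvd_of_mem_factors hP
  suffices hQu : IsUnit Q by
    rw [hQ, irreducible_mul_isUnit hQu]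
    exact hPp.irreducible
  by_contra hQu
  have hQ0 : Q ≠ 0 := by
    rintro rfl
    exact hΔ0 (by rw [hQ, mul_zero])
  obtain ⟨P', hP'i, hP'Q⟩ := WfDvdMonoid.exists_irreducible_factor hQu hQ0
  have hP'p := hP'i.prime
  have : (Ideal.span {P'}).IsPrime := (Ideal.span_singleton_prime hP'p.ne_zero).mpr hP'p
  have hmem : P ∈ Ideal.span {P'} := by
    rw [← IsPrime.vanishingIdeal_zeroLocus (K := k) (Ideal.span {P'}), mem_vanishingIdeal_iff]
    intro p hp
    have hpP' : eval p P' = 0 := hp P' (Ideal.mem_span_singleton_self P')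
    refine hPV p ?_
    obtain ⟨Q', rfl⟩ := hP'Q
    rw [hQ, map_mul, map_mul, hpP', zero_mul, mul_zero]
  have hPP' : P ∣ P' := (hPp.irreducible.associated_of_dvd hP'i
    (Ideal.mem_span_singleton.mp hmem |> fun hd => (hP'i.dvd_symm hPp.irreducible hd))).dvd
  have hsq : P * P ∣ Δ := by
    rw [hQ]
    exact mul_dvd_mul_left P (hPP'.trans hP'Q)
  have hunit := hsep.squarefree (aeval c P) (by rw [← map_mul]; exact map_dvd (aeval c) hsq)
  have hroot : (aeval c P).eval t = 0 := by rw [eval_aeval_path]; exact hPV _ hpt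
  have := hunit.map (Polynomial.evalRingHom t)
  rw [Polynomial.coe_evalRingHom, hroot] at this
  exact not_isUnit_zero this

end Irreducible

end HyperellipticCurve

namespace HyperellipticCurve

open MvPolynomial CategoryTheory CategoryTheory.Limits AlgebraicGeometry

/-! ### Smoothness of plane curves -/

section PlaneCurves

/-- First-order Taylor expansion, exact because all products of increments vanish. -/
theorem aeval_add_of_mul_eq_zero {R S σ : Type*} [CommRing R] [CommRing S] [Algebra R S]
    [Fintype σ] (v h : σ → S) (hh : ∀ i j, h i * h j = 0) (F : MvPolynomial σ R) :
    aeval (fun i => v i + h i) F = aeval v F + ∑ i, h i * aeval v (pderiv i F) := by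
  classical
  induction F using MvPolynomial.induction_on with
  | C r => simp
  | add p q hp hq =>
    simp only [map_add, hp, hq, mul_add, Finset.sum_add_distrib]; ring
  | mul_X p j hp =>
    have e : (∑ i, h i * aeval v (pderiv i (p * X j))) =
        (∑ i, h i * aeval v (pderiv i p)) * v j + h j * aeval v p := by
      simp only [pderiv_mul, map_add, map_mul, aeval_X, mul_add, Finset.sum_add_distrib,
        pderiv_X, Finset.sum_mul]
      congr 1
      · exact Finset.sum_congr rfl fun _ _ => by ring
      · rw [Finset.sum_eq_single j]
        · simp
        · intro b _ hb
          simp [Pi.single_eq_of_ne' hb]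
        · simp
    have e2 : (∑ i, h i * aeval v (pderiv i p)) * h j = 0 := by
      rw [Finset.sum_mul]
      refine Finset.sum_eq_zero fun i _ => ?_
      rw [mul_right_comm, hh, zero_mul]
    rw [map_mul, aeval_X, hp, e, map_mul, aeval_X]
    linear_combination e2

variable {k : Type*} [Field k]

/-- By the Nullstellensatz, a maximal ideal containing f and its partial derivatives would be a
singular point, so these generate the unit ideal. -/
theorem exists_sum_mul_pderiv_eq_one [IsAlgClosed k] {f : MvPolynomial (Fin 2) k}
    (hf : ∀ p, ¬ IsSingularPoint f p) :
    ∃ (c : MvPolynomial (Fin 2) k) (a : Fin 2 → MvPolynomial (Fin 2) k),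
      ∑ i, a i * pderiv i f = 1 + c * f := by
  have htop : Ideal.span {f} ⊔ Ideal.span (Set.range fun i => pderiv i f) = ⊤ := by
    by_contra hne
    obtain ⟨M, hM, hle⟩ := Ideal.exists_le_maximal _ hne
    obtain ⟨p, hp⟩ := eq_vanishingIdeal_singleton_of_isMaximal k hM
    have hmem : ∀ g ∈ M, eval p g = 0 := fun g hg => by
      rw [hp, mem_vanishingIdeal_singleton_iff] at hg
      exact hg
    refine hf p ⟨hmem f (hle (Ideal.mem_sup_left (Ideal.mem_span_singleton_self f))), fun i => ?_⟩
    exact hmem _ (hle (Ideal.mem_sup_right (Ideal.subset_span ⟨i, rfl⟩)))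
  have h1 := (Ideal.eq_top_iff_one _).mp htop
  obtain ⟨x, hx, y, hy, hxy⟩ := Submodule.mem_sup.mp h1
  obtain ⟨c, rfl⟩ := Ideal.mem_span_singleton'.mp hx
  obtain ⟨a, rfl⟩ := (Ideal.mem_span_range_iff_exists_fun).mp hy
  exact ⟨-c, a, by linear_combination hxy⟩

theorem algHom_mk_eq_aeval {S : Type*} [CommRing S] [Algebra k S] {f : MvPolynomial (Fin 2) k}
    (φ : MvPolynomial (Fin 2) k ⧸ Ideal.span {f} →ₐ[k] S) (g : MvPolynomial (Fin 2) k) :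
    φ (Ideal.Quotient.mk _ g) = aeval (fun i => φ (Ideal.Quotient.mk _ (X i))) g := by
  have : φ.comp (Ideal.Quotient.mkₐ k (Ideal.span {f})) =
      aeval (fun i => φ (Ideal.Quotient.mk _ (X i))) := by
    ext i; simp
  exact congrArg (fun ψ : _ →ₐ[k] S => ψ g) this

theorem aeval_algHom_mk_eq_zero {S : Type*} [CommRing S] [Algebra k S]
    {f : MvPolynomial (Fin 2) k} (φ : MvPolynomial (Fin 2) k ⧸ Ideal.span {f} →ₐ[k] S) :
    aeval (fun i => φ (Ideal.Quotient.mk _ (X i))) f = 0 := by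
  rw [← algHom_mk_eq_aeval, Ideal.Quotient.eq_zero_iff_mem.mpr (Ideal.mem_span_singleton_self f),
    map_zero]

theorem exists_algHom_of_aeval_eq_zero {S : Type*} [CommRing S] [Algebra k S]
    {f : MvPolynomial (Fin 2) k} {v : Fin 2 → S} (hv : aeval v f = 0) :
    ∃ φ : MvPolynomial (Fin 2) k ⧸ Ideal.span {f} →ₐ[k] S,
      ∀ i, φ (Ideal.Quotient.mk _ (X i)) = v i := by
  refine ⟨Ideal.Quotient.liftₐ _ (aeval v) ?_, fun i => ?_⟩
  · intro a ha
    obtain ⟨b, rfl⟩ := Ideal.mem_span_singleton'.mp ha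
    rw [map_mul, hv, mul_zero]
  · exact aeval_X _ _

theorem algHom_quotient_ext {S : Type*} [CommRing S] [Algebra k S] {f : MvPolynomial (Fin 2) k}
    {φ ψ : MvPolynomial (Fin 2) k ⧸ Ideal.span {f} →ₐ[k] S}
    (h : ∀ i, φ (Ideal.Quotient.mk _ (X i)) = ψ (Ideal.Quotient.mk _ (X i))) : φ = ψ := by
  ext x
  obtain ⟨g, rfl⟩ := Ideal.Quotient.mk_surjective x
  rw [algHom_mk_eq_aeval, algHom_mk_eq_aeval]
  simp only [h]

/-- The Jacobian criterion. -/
theorem smooth_of_forall_not_isSingularPoint [IsAlgClosed k] {f : MvPolynomial (Fin 2) k}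
    (hf : ∀ p, ¬ IsSingularPoint f p) :
    Algebra.Smooth k (MvPolynomial (Fin 2) k ⧸ Ideal.span {f}) := by
  obtain ⟨c, a, hca⟩ := exists_sum_mul_pderiv_eq_one hf
  have hfp : Algebra.FinitePresentation k (MvPolynomial (Fin 2) k ⧸ Ideal.span {f}) :=
    Algebra.FinitePresentation.quotient ⟨{f}, by simp⟩
  refine ⟨Algebra.FormallySmooth.of_comp_surjective fun B _ _ I hI g => ?_, hfp⟩
  have hII : ∀ x ∈ I, ∀ y ∈ I, x * y = 0 := fun x hx y hy => by
    have : x * y ∈ I ^ 2 := by rw [pow_two]; exact Ideal.mul_mem_mul hx hy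
    rw [hI] at this
    exact this
  choose v hv using fun i => Ideal.Quotient.mk_surjective (g (Ideal.Quotient.mk _ (X i)))
  have hvI : aeval v f ∈ I := by
    have h0 := aeval_algHom_mk_eq_zero g
    rw [← Ideal.Quotient.eq_zero_iff_mem, ← Ideal.Quotient.mkₐ_eq_mk k, ← AlgHom.comp_apply,
      comp_aeval]
    simpa [hv] using h0
  -- A Newton step: the correction -f(v) a(v) changes f(v) to f(v) - f(v) (1 + c f(v)) = -c f(v)²,
  -- which is 0 since I² = 0.
  have hz : aeval (fun i => v i + -(aeval v f * aeval v (a i))) f = 0 := by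
    rw [aeval_add_of_mul_eq_zero]
    · have h1 := congrArg (aeval v) hca
      rw [map_sum, map_add, map_mul, map_one] at h1
      simp only [map_mul] at h1
      have h2 : ∑ i, -(aeval v f * aeval v (a i)) * aeval v (pderiv i f) =
          -(aeval v f * ∑ i, aeval v (a i) * aeval v (pderiv i f)) := by
        rw [Finset.mul_sum, ← Finset.sum_neg_distrib]
        exact Finset.sum_congr rfl fun _ _ => by ring
      rw [h2, h1]
      linear_combination (-(aeval v c)) * hII _ hvI _ hvI
    · intro i j
      linear_combination (aeval v (a i) * aeval v (a j)) * hII _ hvI _ hvI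
  obtain ⟨φ, hφ⟩ := exists_algHom_of_aeval_eq_zero hz
  refine ⟨φ, algHom_quotient_ext fun i => ?_⟩
  rw [AlgHom.comp_apply, hφ, Ideal.Quotient.mkₐ_eq_mk, map_add, hv, add_eq_left,
    Ideal.Quotient.eq_zero_iff_mem]
  exact I.neg_mem (I.mul_mem_right _ hvI)

end PlaneCurves

/-! ### Singular points of the charts -/

section Charts

variable {k : Type*} [Field k] {A B : MvPolynomial (Fin 2) k}

theorem aeval_aeval_chart {S : Type*} [CommRing S] [Algebra k S] (v : Fin 2 → S)
    (F : MvPolynomial (Fin 2) k) :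
    aeval v (aeval ![X 0, 1] F : MvPolynomial (Fin 2) k) = aeval ![v 0, 1] F := by
  rw [← AlgHom.comp_apply, comp_aeval]
  congr 2
  ext i; fin_cases i <;> simp

theorem aeval_chartEquation {S : Type*} [CommRing S] [Algebra k S] (v : Fin 2 → S) :
    aeval v (chartEquation A B) = v 1 ^ 2 + aeval ![v 0, 1] A * v 1 - aeval ![v 0, 1] B := by
  rw [chartEquation, map_sub, map_add, map_mul, map_pow, aeval_X, aeval_aeval_chart,
    aeval_aeval_chart]

theorem pderiv_zero_aeval_chart (F : MvPolynomial (Fin 2) k) :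
    pderiv 0 (aeval ![X 0, 1] F : MvPolynomial (Fin 2) k) = aeval ![X 0, 1] (pderiv 0 F) := by
  rw [pderiv_aeval, Fin.sum_univ_two]
  simp

theorem pderiv_one_aeval_chart (F : MvPolynomial (Fin 2) k) :
    pderiv 1 (aeval ![X 0, 1] F : MvPolynomial (Fin 2) k) = 0 := by
  rw [pderiv_aeval, Fin.sum_univ_two]
  simp [pderiv_X]

/-- In characteristic two the z-derivative 2z + A is just A. -/
theorem isSingularPoint_chartEquation_iff [CharP k 2] (p : Fin 2 → k) :
    IsSingularPoint (chartEquation A B) p ↔ eval ![p 0, 1] A = 0 ∧ p 1 ^ 2 = eval ![p 0, 1] B ∧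
      eval ![p 0, 1] (pderiv 0 A) * p 1 = eval ![p 0, 1] (pderiv 0 B) := by
  have h2 : (2 : k) = 0 := CharTwo.two_eq_zero
  have e : ∀ F, eval p (aeval ![X 0, 1] F : MvPolynomial (Fin 2) k) = eval ![p 0, 1] F := fun F => by
    rw [← aeval_eq_eval, ← aeval_eq_eval]
    exact aeval_aeval_chart p F
  have e0 : eval p (chartEquation A B) = p 1 ^ 2 + eval ![p 0, 1] A * p 1 - eval ![p 0, 1] B := by
    rw [chartEquation]
    simp only [map_sub, map_add, map_mul, map_pow, e, eval_X]
  have e1 : eval p (pderiv 0 (chartEquation A B)) =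
      eval ![p 0, 1] (pderiv 0 A) * p 1 - eval ![p 0, 1] (pderiv 0 B) := by
    rw [chartEquation, map_sub, map_add, pderiv_mul, pderiv_pow, pderiv_zero_aeval_chart,
      pderiv_zero_aeval_chart, pderiv_X_of_ne (by decide : (1 : Fin 2) ≠ 0)]
    simp only [map_sub, map_mul, e, eval_X, mul_zero, add_zero, zero_add]
  have e2 : eval p (pderiv 1 (chartEquation A B)) = eval ![p 0, 1] A := by
    rw [chartEquation, map_sub, map_add, pderiv_mul, pderiv_pow, pderiv_one_aeval_chart,
      pderiv_one_aeval_chart, pderiv_X_self, sub_zero, zero_mul, zero_add, mul_one, mul_one,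
      map_add, e, map_mul, map_natCast, Nat.cast_ofNat, h2, zero_mul, zero_add]
  rw [IsSingularPoint, Fin.forall_fin_two, e0, e1, e2]
  constructor
  · rintro ⟨h0, h1, h3⟩
    rw [h3, zero_mul, add_zero] at h0
    exact ⟨h3, sub_eq_zero.mp h0, sub_eq_zero.mp h1⟩
  · rintro ⟨h3, h0, h1⟩
    rw [h3, h0, h1]
    simp

/-- Over a zero of A the only point has z² = B. Squaring is injective, so A_X z = B_X is equivalent
to its square A_X² B = B_X². -/
theorem exists_isSingularPoint_chartEquation_iff [CharP k 2] [IsAlgClosed k] :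
    (∃ p, IsSingularPoint (chartEquation A B) p) ↔
      ∃ x, eval ![x, 1] A = 0 ∧ eval ![x, 1] (singForm 0 A B) = 0 := by
  have hs : ∀ x : k, eval ![x, 1] (singForm 0 A B) =
      eval ![x, 1] (pderiv 0 A) ^ 2 * eval ![x, 1] B + eval ![x, 1] (pderiv 0 B) ^ 2 := by
    intro x; simp [singForm]
  constructor
  · rintro ⟨p, hp⟩
    rw [isSingularPoint_chartEquation_iff] at hp
    refine ⟨p 0, hp.1, ?_⟩
    rw [hs, ← hp.2.1, ← hp.2.2, ← mul_pow, CharTwo.add_self_eq_zero]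
  · rintro ⟨x, hx, hx'⟩
    obtain ⟨z, hz⟩ := IsAlgClosed.exists_pow_nat_eq (eval ![x, 1] B) (n := 2) two_pos
    refine ⟨![x, z], ?_⟩
    rw [isSingularPoint_chartEquation_iff]
    refine ⟨hx, hz, ?_⟩
    rw [hs, ← hz, ← mul_pow, CharTwo.add_eq_zero] at hx'
    exact CharTwo.sq_injective hx'

theorem eval_swapForm (F : MvPolynomial (Fin 2) k) (x y : k) :
    eval ![x, y] (swapForm F) = eval ![y, x] F := by
  rw [← aeval_eq_eval, ← aeval_eq_eval]
  exact aeval_swapForm F x y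

theorem pderiv_zero_swapForm (F : MvPolynomial (Fin 2) k) :
    pderiv 0 (swapForm F) = swapForm (pderiv 1 F) := by
  rw [swapForm, pderiv_aeval, Fin.sum_univ_two]
  simp [swapForm, pderiv_X]

theorem pderiv_one_swapForm (F : MvPolynomial (Fin 2) k) :
    pderiv 1 (swapForm F) = swapForm (pderiv 0 F) := by
  rw [swapForm, pderiv_aeval, Fin.sum_univ_two]
  simp [swapForm, pderiv_X]

theorem singForm_zero_swapForm (A B : MvPolynomial (Fin 2) k) :
    singForm 0 (swapForm A) (swapForm B) = swapForm (singForm 1 A B) := by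
  rw [singForm, singForm, pderiv_zero_swapForm, pderiv_zero_swapForm]
  simp [swapForm]

/-- Points with y ≠ 0 scale to the first chart, the remaining one to the second. In each chart one
S-form suffices, since x² S₀ = y² S₁ at zeros of A. -/
theorem hasSingularFibre_iff {m : ℕ} [CharP k 2] [IsAlgClosed k] (hm : 1 ≤ m)
    (hA : A.IsHomogeneous m) (hB : B.IsHomogeneous (2 * m)) :
    HasSingularFibre A B ↔ (∃ p, IsSingularPoint (chartEquation A B) p) ∨
      ∃ p, IsSingularPoint (chartEquation (swapForm A) (swapForm B)) p := by
  rw [exists_isSingularPoint_chartEquation_iff, exists_isSingularPoint_chartEquation_iff]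
  simp only [singForm_zero_swapForm, eval_swapForm]
  have h0 := singForm_isHomogeneous hm hA hB 0
  have h1 := singForm_isHomogeneous hm hA hB 1
  constructor
  · rintro ⟨x, y, hxy, hp, hs⟩
    by_cases hy : y = 0
    · right
      have hx : x ≠ 0 := by tauto
      have e : ![1, x⁻¹ * y] = ![x⁻¹ * x, x⁻¹ * y] := by rw [inv_mul_cancel₀ hx]
      refine ⟨x⁻¹ * y, ?_, ?_⟩
      · rw [e, eval_smul_of_isHomogeneous hA, hp, mul_zero]
      · rw [e, eval_smul_of_isHomogeneous h1, hs, mul_zero]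
    · left
      have e : ![y⁻¹ * x, 1] = ![y⁻¹ * x, y⁻¹ * y] := by rw [inv_mul_cancel₀ hy]
      refine ⟨y⁻¹ * x, ?_, ?_⟩
      · rw [e, eval_smul_of_isHomogeneous hA, hp, mul_zero]
      · rw [e, eval_smul_of_isHomogeneous h0, hs, mul_zero]
  · rintro (⟨x, hp, hs⟩ | ⟨x, hp, hs⟩)
    · refine ⟨x, 1, Or.inr one_ne_zero, hp, Fin.forall_fin_two.mpr ⟨hs, ?_⟩⟩
      have := sq_mul_eval_singForm hA hB hp
      rw [hs] at this
      simpa using this.symm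
    · refine ⟨1, x, Or.inl one_ne_zero, hp, Fin.forall_fin_two.mpr ⟨?_, hs⟩⟩
      have := sq_mul_eval_singForm hA hB hp
      rw [hs] at this
      simpa using this

theorem aeval_chart_add {R : Type*} [CommRing R] [Algebra k R] {t : R} (ht : t ^ 3 = 0) (x : k)
    (u : R) (F : MvPolynomial (Fin 2) k) :
    aeval ![algebraMap k R x + t ^ 2 * u, 1] F = algebraMap k R (eval ![x, 1] F) +
      t ^ 2 * u * algebraMap k R (eval ![x, 1] (pderiv 0 F)) := by
  have h := aeval_add_of_mul_eq_zero (R := k) ![algebraMap k R x, 1] ![t ^ 2 * u, 0]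
    (by
      intro i j
      fin_cases i <;> fin_cases j <;> simp
      linear_combination t * u ^ 2 * ht) F
  have e1 : (fun i => (![algebraMap k R x, 1] : Fin 2 → R) i +
      (![t ^ 2 * u, 0] : Fin 2 → R) i) = ![algebraMap k R x + t ^ 2 * u, 1] := by
    ext i; fin_cases i <;> simp
  have e2 : ∀ G : MvPolynomial (Fin 2) k, aeval ![algebraMap k R x, 1] G =
      algebraMap k R (eval ![x, 1] G) := by
    intro G
    rw [← aeval_eq_eval, ← aeval_algebraMap_apply]
    congr 2
    ext i; fin_cases i <;> simp
  rw [e1, e2, Fin.sum_univ_two, e2, e2] at h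
  rw [h]
  simp

/-- An algebra homomorphism to `R / (t²)`, with `t³ = 0`, that does not lift to `R`. -/
theorem not_formallySmooth_of_isSingularPoint_of_pow [CharP k 2] {p : Fin 2 → k}
    (hp : IsSingularPoint (chartEquation A B) p) {R : Type*} [CommRing R] [Algebra k R] {t : R}
    (ht3 : t ^ 3 = 0) (ht2 : t ^ 2 ≠ 0) : ¬ Algebra.FormallySmooth k (ChartRing A B) := by
  intro hfs
  rw [isSingularPoint_chartEquation_iff] at hp
  obtain ⟨hA, hB, hAB⟩ := hp
  have h2 : (2 : R) = 0 := by
    have : algebraMap k R 2 = 0 := by rw [CharTwo.two_eq_zero, map_zero]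
    rwa [map_ofNat] at this
  have hI : Ideal.span {t ^ 2} ^ 2 = ⊥ := by
    rw [Ideal.span_singleton_pow, Ideal.span_singleton_eq_bot]
    linear_combination t * ht3
  generalize hI' : Ideal.span {t ^ 2} = I at hI
  -- Since A vanishes at the point and (z + t)² = z² + t², the shifted point solves the equation
  -- modulo t². Any lift alters the coordinates by multiples of t², and by singularity and t³ = 0
  -- the equation still takes the value t² ≠ 0.
  have e : aeval ![algebraMap k R (p 0), algebraMap k R (p 1) + t] (chartEquation A B) = t ^ 2 := by
    have kA := aeval_chart_add ht3 (p 0) 0 A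
    have kB := aeval_chart_add ht3 (p 0) 0 B
    rw [mul_zero, add_zero, zero_mul, add_zero] at kA kB
    rw [aeval_chartEquation]
    simp only [Matrix.cons_val_zero, Matrix.cons_val_one, Matrix.cons_val_fin_one]
    rw [kA, kB, hA, ← hB, map_pow, map_zero]
    linear_combination (algebraMap k R (p 1) * t) * h2
  have hg : aeval (fun i => Ideal.Quotient.mkₐ k I
      ((![algebraMap k R (p 0), algebraMap k R (p 1) + t] : Fin 2 → R) i))
      (chartEquation A B) = 0 := by
    rw [← comp_aeval_apply, e, Ideal.Quotient.mkₐ_eq_mk, Ideal.Quotient.eq_zero_iff_mem, ← hI']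
    exact Ideal.mem_span_singleton_self _
  obtain ⟨g, hg⟩ := exists_algHom_of_aeval_eq_zero hg
  obtain ⟨f, hf⟩ := Algebra.FormallySmooth.comp_surjective k (ChartRing A B) I hI g
  have hfi : ∀ i, ∃ w, f (Ideal.Quotient.mk _ (X i)) =
      (![algebraMap k R (p 0), algebraMap k R (p 1) + t] : Fin 2 → R) i + t ^ 2 * w := by
    intro i
    have h1 := DFunLike.congr_fun hf (Ideal.Quotient.mk _ (X i))
    rw [AlgHom.comp_apply, hg, Ideal.Quotient.mkₐ_eq_mk, Ideal.Quotient.eq, ← hI',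
      Ideal.mem_span_singleton] at h1
    obtain ⟨w, hw⟩ := h1
    exact ⟨w, by linear_combination hw⟩
  obtain ⟨u, hu⟩ := hfi 0
  obtain ⟨w, hw⟩ := hfi 1
  have h := aeval_algHom_mk_eq_zero f
  rw [aeval_chartEquation, hu, hw] at h
  simp only [Matrix.cons_val_zero, Matrix.cons_val_one, Matrix.cons_val_fin_one] at h
  rw [aeval_chart_add ht3, aeval_chart_add ht3, hA, ← hB, ← hAB, map_pow, map_zero, map_mul] at h
  refine ht2 ?_
  generalize algebraMap k R (p 1) = z at *
  generalize algebraMap k R (eval ![p 0, 1] (pderiv 0 A)) = d at *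
  linear_combination h - (z * t + z * t ^ 2 * w) * h2 -
    (2 * w + t * w ^ 2 + u * d + t * u * d * w) * ht3

theorem not_formallySmooth_of_isSingularPoint [CharP k 2] {p : Fin 2 → k}
    (hp : IsSingularPoint (chartEquation A B) p) : ¬ Algebra.FormallySmooth k (ChartRing A B) := by
  -- The test ring is k[t] / (t³).
  refine not_formallySmooth_of_isSingularPoint_of_pow hp
    (t := Ideal.Quotient.mk (Ideal.span {(Polynomial.X : Polynomial k) ^ 3}) Polynomial.X) ?_ ?_
  · rw [← map_pow, Ideal.Quotient.eq_zero_iff_mem]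
    exact Ideal.mem_span_singleton_self _
  · rw [← map_pow, Ne, Ideal.Quotient.eq_zero_iff_mem, Ideal.mem_span_singleton,
      Polynomial.X_pow_dvd_iff]
    push Not
    exact ⟨2, by norm_num, by simp⟩

theorem smooth_chartRing_iff [CharP k 2] [IsAlgClosed k] :
    Algebra.Smooth k (ChartRing A B) ↔ ¬ ∃ p, IsSingularPoint (chartEquation A B) p := by
  constructor
  · rintro h ⟨p, hp⟩
    exact not_formallySmooth_of_isSingularPoint hp h.formallySmooth
  · intro h
    exact smooth_of_forall_not_isSingularPoint (not_exists.mp h)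

end Charts

/-! ### Smoothness of the curve -/

section Curve

universe u

/-- Smoothness is local on the source, and the pushout along open immersions is covered by the two
charts and their overlap; the overlap is open in a chart, hence adds no condition. -/
theorem smooth_pushout_desc_iff {U V W S : Scheme.{u}} (f : U ⟶ V) (g : U ⟶ W) [IsOpenImmersion f]
    [IsOpenImmersion g] [HasPushout f g] (a : V ⟶ S) (b : W ⟶ S) (h : f ≫ a = g ≫ b) :
    Smooth (pushout.desc a b h) ↔ Smooth a ∧ Smooth b := by
  have h1 (i j : WalkingSpan) (h : i ⟶ j) : IsOpenImmersion ((span f g).map h) := by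
    rcases h with _ | (_ | _)
    · exact inferInstanceAs (IsOpenImmersion (𝟙 ((span f g).obj i)))
    · simpa
    · simpa
  have : ∀ {i j : WalkingSpan} (h : i ⟶ j), IsOpenImmersion ((span f g).map h) := h1 _ _
  have : IsZariskiLocalAtSource (@Smooth.{u}) := by
    have : HasRingHomProperty (@Smooth.{u}) RingHom.Smooth := inferInstance
    exact @HasRingHomProperty.instIsZariskiLocalAtSource @Smooth.{u} RingHom.Smooth this
  rw [IsZariskiLocalAtSource.iff_of_openCover (P := @Smooth.{u})
    (Scheme.IsLocallyDirected.openCover (span f g))]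
  have hl : colimit.ι (span f g) WalkingSpan.left ≫ pushout.desc a b h = a :=
    pushout.inl_desc a b h
  have hr : colimit.ι (span f g) WalkingSpan.right ≫ pushout.desc a b h = b :=
    pushout.inr_desc a b h
  constructor
  · intro hs
    have s1 := hs WalkingSpan.left
    have s2 := hs WalkingSpan.right
    rw [Scheme.IsLocallyDirected.openCover_f] at s1 s2
    exact ⟨hl ▸ s1, hr ▸ s2⟩
  · rintro ⟨s1, s2⟩ (_ | _ | _)
    · rw [Scheme.IsLocallyDirected.openCover_f]
      have h0 : colimit.ι (span f g) WalkingSpan.zero ≫ pushout.desc a b h = f ≫ a := by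
        rw [← colimit.w (span f g) WalkingSpan.Hom.fst, Category.assoc, hl]
        rfl
      have : Smooth (f ≫ a) := inferInstance
      exact h0 ▸ this
    · rw [Scheme.IsLocallyDirected.openCover_f]
      exact hl.symm ▸ s1
    · rw [Scheme.IsLocallyDirected.openCover_f]
      exact hr.symm ▸ s2

variable {k : Type*} [Field k] [CharP k 2] [IsAlgClosed k] {m : ℕ} {A B : MvPolynomial (Fin 2) k}

theorem smooth_chart_iff (A B : MvPolynomial (Fin 2) k) :
    Smooth (Spec.map (CommRingCat.ofHom (algebraMap k (ChartRing A B)))) ↔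
      ¬ ∃ p, IsSingularPoint (chartEquation A B) p := by
  rw [HasRingHomProperty.Spec_iff (P := @Smooth), CommRingCat.hom_ofHom, RingHom.smooth_algebraMap,
    smooth_chartRing_iff]

theorem smooth_curveToSpec_iff (hm : 1 ≤ m) (hA : A.IsHomogeneous m)
    (hB : B.IsHomogeneous (2 * m)) :
    Smooth (curveToSpec hA hB) ↔ ¬ HasSingularFibre A B := by
  refine (smooth_pushout_desc_iff _ _ _ _ _).trans ?_
  rw [smooth_chart_iff, smooth_chart_iff, hasSingularFibre_iff hm hA hB, not_or]

end Curve

end HyperellipticCurve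

/-! ## Forms with a double root, and nodes -/

namespace HyperellipticCurve

open MvPolynomial

section Discriminant

variable {k : Type*} [Field k]

theorem derivative_dehomogenize (F : MvPolynomial (Fin 2) k) :
    (dehomogenize F).derivative = dehomogenize (pderiv 0 F) := by
  induction F using MvPolynomial.induction_on with
  | C r => simp [dehomogenize, Polynomial.algebraMap_eq]
  | add p q hp hq =>
    simp only [dehomogenize, map_add] at *
    rw [hp, hq]
  | mul_X p i hp =>
    rw [pderiv_mul, dehomogenize_mul, Polynomial.derivative_mul, hp]
    fin_cases i <;> simp [dehomogenize, pderiv_X]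

/-- `a₀` times the discriminant is, up to sign, the resultant of a form and its derivative. -/
theorem eval_mul_formDiscr {m : ℕ} (hm : 1 ≤ m) {A : MvPolynomial (Fin 2) k}
    (hA : A.IsHomogeneous m) :
    Polynomial.resultant (dehomogenize A) (dehomogenize A).derivative m (m - 1) =
      (-1) ^ (m * (m - 1) / 2) * eval ![1, 0] A * formDiscr m A := by
  set G : MvPolynomial (Fin 2) (MvPolynomial (Fin (m + 1)) k) := binaryForm m fun i => X i with hG
  have hGh : G.IsHomogeneous m := binaryForm_isHomogeneous _ _
  have hc : (dehomogenize G).coeff m = X 0 := by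
    rw [coeff_dehomogenize_top hGh, ← formCoeff_zero_eq hGh, hG, formCoeff_binaryForm]
  have hd : (dehomogenize G).natDegree = m :=
    le_antisymm (natDegree_dehomogenize_le hGh)
      (Polynomial.le_natDegree_of_ne_zero (by rw [hc]; exact X_ne_zero _))
  have h := Polynomial.resultant_deriv (f := dehomogenize G)
    (Polynomial.natDegree_pos_iff_degree_pos.mp (by omega))
  have hmap : map (eval (formCoeff m A)) G = A := by
    rw [hG, map_binaryForm]
    simp only [eval_X]
    exact binaryForm_formCoeff hA
  rw [Polynomial.leadingCoeff, hd, hc] at h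
  have h2 := congrArg (eval (formCoeff m A)) h
  rw [← Polynomial.resultant_map_map, ← Polynomial.derivative_map, map_dehomogenize, hmap, map_mul,
    map_mul, map_pow, map_neg, map_one, eval_X, formCoeff_zero_eq hA] at h2
  exact h2

/-- The resultant of A and its derivative lies in the ideal they generate, so it vanishes at a
common root; the factor a₀ ≠ 0 can then be cancelled. -/
theorem formDiscr_eq_zero_of_double_root {m : ℕ} (hm : 1 ≤ m) {A : MvPolynomial (Fin 2) k}
    (hA : A.IsHomogeneous m) (h0 : eval ![1, 0] A ≠ 0) {x : k} (hx : eval ![x, 1] A = 0)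
    (hx' : eval ![x, 1] (pderiv 0 A) = 0) : formDiscr m A = 0 := by
  have hr : Polynomial.resultant (dehomogenize A) (dehomogenize A).derivative m (m - 1) = 0 := by
    have hd := natDegree_dehomogenize_le hA
    obtain ⟨p, q, -, -, hpq⟩ := Polynomial.exists_mul_add_mul_eq_C_resultant (dehomogenize A)
      (dehomogenize A).derivative (m := m) (n := m - 1) hd
      ((Polynomial.natDegree_derivative_le _).trans (Nat.sub_le_sub_right hd 1)) (by omega)
    have := congrArg (Polynomial.eval x) hpq
    rw [Polynomial.eval_add, Polynomial.eval_mul, Polynomial.eval_mul, derivative_dehomogenize,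
      eval_dehomogenize, eval_dehomogenize, hx, hx', Polynomial.eval_C] at this
    rw [derivative_dehomogenize, ← this]
    simp
  rw [eval_mul_formDiscr hm hA] at hr
  simpa [h0] using hr

theorem exists_eval_eq_formDiscr (n : ℕ) (F₀ F₁ F₂ F₃ : MvPolynomial (Fin 2) k) :
    ∃ P : Polynomial k, ∀ t,
      P.eval t = formDiscr n (F₀ + C t * F₁ + C (t ^ 2) * F₂ + C (t ^ 3) * F₃) := by
  refine ⟨aeval (fun i => Polynomial.C (formCoeff n F₀ i) +
    Polynomial.X * Polynomial.C (formCoeff n F₁ i) +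
    Polynomial.X ^ 2 * Polynomial.C (formCoeff n F₂ i) +
    Polynomial.X ^ 3 * Polynomial.C (formCoeff n F₃ i)) (genericDiscr k n), fun t => ?_⟩
  rw [eval_aeval_path, formDiscr]
  congr 2
  ext i
  simp only [formCoeff_add, formCoeff_C_mul, Polynomial.eval_add, Polynomial.eval_mul,
    Polynomial.eval_pow, Polynomial.eval_X, Polynomial.eval_C, Pi.add_apply, Pi.smul_apply,
    smul_eq_mul]

/-- The leading coefficient may vanish, so the form is deformed to (ℓ + t X)² (q + t Xⁿ), with
leading coefficient (a + t)² (q(1, 0) + t) and still a double root. Its discriminant is a polynomial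
in t with infinitely many zeros. Expanding the deformation gives a cubic in t. -/
theorem formDiscr_linForm_sq_mul [CharP k 2] [Infinite k] {n : ℕ} (a b : k)
    {q : MvPolynomial (Fin 2) k} (hq : q.IsHomogeneous n) :
    formDiscr (n + 2) (linForm a b ^ 2 * q) = 0 := by
  set F : k → MvPolynomial (Fin 2) k := fun t =>
    linForm (a + t) b ^ 2 * (q + C t * X 0 ^ n) with hF
  have hFh : ∀ t, (F t).IsHomogeneous (n + 2) := fun t => by
    have h1 := (linForm_isHomogeneous (a + t) b).pow 2
    have h2 : (C t * X 0 ^ n : MvPolynomial (Fin 2) k).IsHomogeneous n := by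
      simpa using (isHomogeneous_C (Fin 2) t).mul ((isHomogeneous_X k (0 : Fin 2)).pow n)
    have := h1.mul (hq.add h2)
    rwa [show 1 * 2 + n = n + 2 by omega] at this
  have hFe : ∀ t, F t = linForm a b ^ 2 * q + C t * (linForm a b ^ 2 * X 0 ^ n) +
      C (t ^ 2) * (X 0 ^ 2 * q) + C (t ^ 3) * (X 0 ^ (n + 2)) := fun t => by
    have h2 : (2 : MvPolynomial (Fin 2) k) = 0 := CharTwo.two_eq_zero
    simp only [hF, linForm, C_add, C_pow]
    linear_combination (C t * X 0 * (C a * X 0 + C b * X 1) * (q + C t * X 0 ^ n)) * h2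
  obtain ⟨P, hP⟩ := exists_eval_eq_formDiscr (n + 2) (linForm a b ^ 2 * q)
    (linForm a b ^ 2 * X 0 ^ n) (X 0 ^ 2 * q) (X 0 ^ (n + 2))
  have hPe : ∀ t, P.eval t = formDiscr (n + 2) (F t) := fun t => by rw [hP, hFe]
  have hP0 : P = 0 := by
    refine eq_zero_of_forall_eval_ne_zero
      (g := (Polynomial.X + Polynomial.C a) ^ 2 * (Polynomial.X + Polynomial.C (eval ![1, 0] q)))
      (mul_ne_zero (pow_ne_zero _ (Polynomial.X_add_C_ne_zero _)) (Polynomial.X_add_C_ne_zero _))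
      fun t ht => ?_
    have ht' : (t + a) ^ 2 * (t + eval ![1, 0] q) ≠ 0 := by simpa using ht
    have hat : a + t ≠ 0 := fun h => ht' (by rw [add_comm t a, h]; simp)
    have hz : (a + t) * ((a + t)⁻¹ * b) + b = 0 := by
      rw [mul_inv_cancel_left₀ hat, CharTwo.add_self_eq_zero]
    rw [hPe]
    refine formDiscr_eq_zero_of_double_root (by omega) (hFh t) ?_ (x := (a + t)⁻¹ * b) ?_ ?_
    · simp only [hF, map_mul, map_pow, map_add, eval_linForm, eval_X, eval_C]
      simpa [add_comm] using ht'
    · simp only [hF, map_mul, map_pow, eval_linForm]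
      simp [hz]
    · rw [hF, pderiv_mul, pderiv_pow]
      simp only [map_mul, map_pow, map_add, eval_linForm]
      simp [hz]
  have h0 := hPe 0
  rw [hP0, Polynomial.eval_zero] at h0
  simpa [hF] using h0.symm

/-- A nonzero form of nonzero discriminant has no double root. -/
theorem exists_eval_pderiv_ne_zero [CharP k 2] [Infinite k] {m : ℕ} {A : MvPolynomial (Fin 2) k}
    (hA : A.IsHomogeneous m) (hA0 : A ≠ 0) (hd : formDiscr m A ≠ 0) {x y : k}
    (hxy : x ≠ 0 ∨ y ≠ 0) (h : eval ![x, y] A = 0) : ∃ i, eval ![x, y] (pderiv i A) ≠ 0 := by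
  have hc : ∀ {G : MvPolynomial (Fin 2) k}, G.IsHomogeneous 0 → eval ![x, y] G = 0 → G = 0 := by
    intro G hG hG0
    obtain ⟨c, rfl⟩ : ∃ c, G = C c := ⟨_, totalDegree_eq_zero_iff_eq_C.mp
      (Nat.le_zero.mp hG.totalDegree_le)⟩
    rw [eval_C] at hG0
    rw [hG0, map_zero]
  by_contra! hi
  rcases m with _ | n
  · exact hA0 (hc hA h)
  obtain ⟨G, hG, rfl⟩ := exists_eq_linForm_mul hA hxy h
  have hl : eval ![x, y] (linForm y x) = 0 := by
    rw [eval_linForm]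
    simp [mul_comm y x, CharTwo.add_self_eq_zero]
  have h0 := hi 0
  have h1 := hi 1
  rw [pderiv_mul, map_add, map_mul, map_mul, hl, zero_mul, add_zero] at h0 h1
  have hG0 : eval ![x, y] G = 0 := by
    rcases hxy with hx | hy
    · simpa [linForm, pderiv_X, hx] using h1
    · simpa [linForm, pderiv_X, hy] using h0
  rcases n with _ | n
  · exact hA0 (by rw [hc hG hG0, mul_zero])
  · obtain ⟨q, hq, rfl⟩ := exists_eq_linForm_mul hG hxy hG0
    refine hd ?_
    rw [← mul_assoc, ← pow_two]
    exact formDiscr_linForm_sq_mul y x hq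

end Discriminant

/-! ### Ordinary double points of the charts -/

section Nodes

variable {k : Type*} [Field k]

/-- Taylor expansion to second order. The quadratic coefficient is left existential, since in
characteristic two it is not half a second derivative. -/
theorem exists_aeval_chart_expansion (x : k) (F : MvPolynomial (Fin 2) k) :
    ∃ (c : k) (G : MvPolynomial (Fin 2) k),
      (aeval ![X 0 + C x, 1] F : MvPolynomial (Fin 2) k) = C (eval ![x, 1] F) +
        C (eval ![x, 1] (pderiv 0 F)) * X 0 + C c * X 0 ^ 2 + X 0 ^ 3 * G := by
  induction F using MvPolynomial.induction_on with
  | C r => exact ⟨0, 0, by simp [algebraMap_eq]⟩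
  | add p q hp hq =>
    obtain ⟨c, G, hp⟩ := hp
    obtain ⟨d, H, hq⟩ := hq
    refine ⟨c + d, G + H, ?_⟩
    rw [map_add, hp, hq]
    simp only [map_add]
    ring
  | mul_X p i hp =>
    obtain ⟨c, G, hp⟩ := hp
    fin_cases i
    · refine ⟨eval ![x, 1] (pderiv 0 p) + c * x, C c + G * (X 0 + C x), ?_⟩
      have e1 : eval ![x, 1] (p * X 0) = eval ![x, 1] p * x := by simp
      have e2 : eval ![x, 1] (pderiv 0 (p * X 0)) =
          eval ![x, 1] (pderiv 0 p) * x + eval ![x, 1] p := by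
        rw [pderiv_mul]; simp
      have e3 : (aeval ![X 0 + C x, 1] (X 0 : MvPolynomial (Fin 2) k) : MvPolynomial (Fin 2) k) =
          X 0 + C x := by rw [aeval_X]; rfl
      change aeval ![X 0 + C x, 1] (p * X 0) = C (eval ![x, 1] (p * X 0)) +
        C (eval ![x, 1] (pderiv 0 (p * X 0))) * X 0 + _ + _
      rw [map_mul, hp, e1, e2, e3]
      simp only [map_add, map_mul]
      ring
    · refine ⟨c, G, ?_⟩
      have e1 : eval ![x, 1] (p * X 1) = eval ![x, 1] p := by simp
      have e2 : eval ![x, 1] (pderiv 0 (p * X 1)) = eval ![x, 1] (pderiv 0 p) := by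
        rw [pderiv_mul, pderiv_X_of_ne (by decide : (1 : Fin 2) ≠ 0)]; simp
      have e3 : (aeval ![X 0 + C x, 1] (X 1 : MvPolynomial (Fin 2) k) : MvPolynomial (Fin 2) k) =
          1 := by rw [aeval_X]; rfl
      change aeval ![X 0 + C x, 1] (p * X 1) = C (eval ![x, 1] (p * X 1)) +
        C (eval ![x, 1] (pderiv 0 (p * X 1))) * X 0 + _ + _
      rw [map_mul, hp, e1, e2, e3, mul_one]

theorem homogeneousComponent_mul_eq_zero {R σ : Type*} [CommSemiring R] {n d : ℕ}
    {F : MvPolynomial σ R} (hF : F.IsHomogeneous d) (hn : n < d) (G : MvPolynomial σ R) :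
    homogeneousComponent n (F * G) = 0 := by
  classical
  refine homogeneousComponent_eq_zero' _ _ fun e he => ?_
  obtain ⟨a, ha, b, hb, rfl⟩ := Finset.mem_add.mp (support_mul F G he)
  have := hF.degree_eq_sum_deg_support ha
  rw [map_add, Finsupp.degree_apply a, ← this]
  omega

/-- With d the X-derivative of A at the point, the quadratic part is z² + d x z + e x². It factors
as (r x + z)((r + d) x + z) with r² + d r + e = 0, and the factors are independent because d ≠ 0. -/
theorem isNode_chartEquation [CharP k 2] [IsAlgClosed k] {A B : MvPolynomial (Fin 2) k}
    {p : Fin 2 → k} (hp : IsSingularPoint (chartEquation A B) p)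
    (hd : eval ![p 0, 1] (pderiv 0 A) ≠ 0) : IsNode (chartEquation A B) p := by
  refine ⟨hp, ?_⟩
  rw [isSingularPoint_chartEquation_iff] at hp
  obtain ⟨hA, hB, hAB⟩ := hp
  obtain ⟨a, G, hG⟩ := exists_aeval_chart_expansion (p 0) A
  obtain ⟨b, H, hH⟩ := exists_aeval_chart_expansion (p 0) B
  set d := eval ![p 0, 1] (pderiv 0 A)
  rw [hA] at hG
  rw [← hB, ← hAB] at hH
  have h2 : (2 : MvPolynomial (Fin 2) k) = 0 := CharTwo.two_eq_zero
  obtain ⟨r, hr⟩ : ∃ r, r ^ 2 + d * r + (a * p 1 + b) = 0 := by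
    obtain ⟨r, hr⟩ := IsAlgClosed.exists_root
      (Polynomial.X ^ 2 + Polynomial.C d * Polynomial.X + Polynomial.C (a * p 1 + b)) (by
        have := Polynomial.degree_quadratic (a := (1 : k)) (b := d) (c := a * p 1 + b) one_ne_zero
        rw [Polynomial.C_1, one_mul] at this
        rw [this]
        decide)
    exact ⟨r, by simpa [Polynomial.IsRoot] using hr⟩
  have hrc : C r ^ 2 + C d * C r + (C a * C (p 1) + C b) = (0 : MvPolynomial (Fin 2) k) := by
    rw [← C_0, ← hr]
    simp only [map_add, map_mul, map_pow]
  refine ⟨![r, 1], ![r + d, 1], ?_, ?_⟩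
  · rw [LinearIndependent.pair_iff]
    intro s t hst
    have h0 := congrFun hst 0
    have h1 := congrFun hst 1
    simp only [Pi.add_apply, Pi.smul_apply, Matrix.cons_val_zero, Matrix.cons_val_one,
      Matrix.cons_val_fin_one, smul_eq_mul, mul_one, Pi.zero_apply] at h0 h1
    have ht : t * d = 0 := by linear_combination h0 - r * h1
    have ht : t = 0 := (mul_eq_zero.mp ht).resolve_right hd
    exact ⟨by rw [ht, add_zero] at h1; exact h1, ht⟩
  · have e : (aeval (fun i => X i + C (p i)) (chartEquation A B) : MvPolynomial (Fin 2) k) =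
        (C r * X 0 + X 1) * (C (r + d) * X 0 + X 1) + (X 0 ^ 2 * X 1) * C a +
          X 0 ^ 3 * (G * (X 1 + C (p 1)) - H) := by
      rw [aeval_chartEquation, hG, hH]
      simp only [map_add, map_mul, map_pow, map_zero]
      linear_combination (-X 0 ^ 2) * hrc + (C (p 1) * X 1 - C r * X 0 * X 1 +
        C a * C (p 1) * X 0 ^ 2) * h2
    have h1 : ((C r * X 0 + X 1) * (C (r + d) * X 0 + X 1) : MvPolynomial (Fin 2) k).IsHomogeneous
        2 := by
      have := (linForm_isHomogeneous r 1).mul (linForm_isHomogeneous (r + d) 1)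
      simpa [linForm] using this
    have h3 : (X 0 ^ 2 * X 1 : MvPolynomial (Fin 2) k).IsHomogeneous 3 :=
      ((isHomogeneous_X k (0 : Fin 2)).pow 2).mul (isHomogeneous_X k (1 : Fin 2))
    have h4 : (X 0 ^ 3 : MvPolynomial (Fin 2) k).IsHomogeneous 3 := by
      simpa using (isHomogeneous_X k (0 : Fin 2)).pow 3
    rw [e, map_add, map_add, homogeneousComponent_mul_eq_zero h3 (by decide),
      homogeneousComponent_mul_eq_zero h4 (by decide), add_zero, add_zero,
      homogeneousComponent_of_mem h1, if_pos rfl]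
    simp [Fin.sum_univ_two]

/-- At a zero (x, 1) of A Euler gives x A_X + A_Y = 0, so A_X = 0 would force both derivatives to
vanish. -/
theorem isNode_of_forall_eval_pderiv_ne_zero [CharP k 2] [IsAlgClosed k] {m : ℕ}
    {A B : MvPolynomial (Fin 2) k} (hA : A.IsHomogeneous m)
    (hd : ∀ x : k, eval ![x, 1] A = 0 → ∃ i, eval ![x, 1] (pderiv i A) ≠ 0) (p : Fin 2 → k)
    (hp : IsSingularPoint (chartEquation A B) p) : IsNode (chartEquation A B) p := by
  refine isNode_chartEquation hp fun h => ?_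
  have hx := (isSingularPoint_chartEquation_iff p).mp hp |>.1
  have he := eval_euler hA ![p 0, 1]
  rw [hx, h] at he
  obtain ⟨i, hi⟩ := hd _ hx
  refine hi ?_
  fin_cases i
  · exact h
  · simpa using he

theorem isNodalCurve_of_formDiscr_ne_zero [CharP k 2] [IsAlgClosed k] {m : ℕ}
    {A B : MvPolynomial (Fin 2) k} (hA : A.IsHomogeneous m) (hA0 : A ≠ 0)
    (hd : formDiscr m A ≠ 0) : IsNodalCurve A B := by
  have : Infinite k := IsAlgClosed.instInfinite
  refine ⟨isNode_of_forall_eval_pderiv_ne_zero hA fun x hx =>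
      exists_eval_pderiv_ne_zero hA hA0 hd (Or.inr one_ne_zero) hx,
    isNode_of_forall_eval_pderiv_ne_zero (swapForm_isHomogeneous hA) fun x hx => ?_⟩
  rw [eval_swapForm] at hx
  obtain ⟨i, hi⟩ := exists_eval_pderiv_ne_zero hA hA0 hd (Or.inl one_ne_zero) hx
  rw [← eval_swapForm] at hi
  fin_cases i
  · exact ⟨1, by rw [pderiv_one_swapForm]; exact hi⟩
  · exact ⟨0, by rw [pderiv_zero_swapForm]; exact hi⟩

end Nodes

end HyperellipticCurve

/-! ### The main theorem -/

theorem mainTheorem2 {k : Type*} [Field k] [IsAlgClosed k] [CharP k 2] (m : ℕ) (hm : 1 ≤ m) :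
    ∃ Δ : MvPolynomial (HyperellipticCurve.CoeffIndex m) k,
      -- the polynomial defined by the resultant
      HyperellipticCurve.IsDelta m Δ ∧
      (∀ Δ₁ : MvPolynomial (HyperellipticCurve.CoeffIndex m) k,
        HyperellipticCurve.IsDelta m Δ₁ → Δ₁ = Δ) ∧
      -- weight, invariance under the additive group, semi-invariance under `GL(2)`
      MvPolynomial.IsWeightedHomogeneous
        (Sum.elim (fun _ => 1) (fun _ => 2) : HyperellipticCurve.CoeffIndex m → ℕ) Δ (8 * m - 4) ∧
      (∀ A B α : MvPolynomial (Fin 2) k,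
        A.IsHomogeneous m → B.IsHomogeneous (2 * m) → α.IsHomogeneous m →
        HyperellipticCurve.evalPair m Δ A (B + α * A + α ^ 2) =
          HyperellipticCurve.evalPair m Δ A B) ∧
      (∀ (σ : GL (Fin 2) k) (A B : MvPolynomial (Fin 2) k),
        A.IsHomogeneous m → B.IsHomogeneous (2 * m) →
        HyperellipticCurve.evalPair m Δ (HyperellipticCurve.substForm σ A)
            (HyperellipticCurve.substForm σ B) =
          (σ : Matrix (Fin 2) (Fin 2) k).det ^ (m * (4 * m - 2)) *
            HyperellipticCurve.evalPair m Δ A B) ∧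
      -- smoothness criterion
      (∀ (A B : MvPolynomial (Fin 2) k) (hA : A.IsHomogeneous m) (hB : B.IsHomogeneous (2 * m)),
        AlgebraicGeometry.Smooth (HyperellipticCurve.curveToSpec hA hB) ↔
          HyperellipticCurve.evalPair m Δ A B ≠ 0) ∧
      -- nodal curves
      (∀ A B : MvPolynomial (Fin 2) k, A.IsHomogeneous m → B.IsHomogeneous (2 * m) → A ≠ 0 →
        HyperellipticCurve.evalPair m Δ A B = 0 → HyperellipticCurve.formDiscr m A ≠ 0 →
        HyperellipticCurve.IsNodalCurve A B) ∧
      -- irreducibility and the zero locus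
      Irreducible Δ ∧
      {p | MvPolynomial.eval p Δ = 0} =
        HyperellipticCurve.zariskiClosure (HyperellipticCurve.orbitZ k m) := by
  obtain ⟨Δ, h⟩ := HyperellipticCurve.exists_isDelta (k := k) hm
  have : Infinite k := IsAlgClosed.instInfinite
  refine ⟨Δ, h, fun Δ₁ h₁ => h.unique h₁, h.isWeightedHomogeneous hm,
    fun A B α hA hB hα => h.evalPair_add_mul_add_sq hm hA hB hα,
    fun σ A B hA hB => h.evalPair_substForm hm σ hA hB, fun A B hA hB => ?_,
    fun A B hA hB hA0 _ hd => HyperellipticCurve.isNodalCurve_of_formDiscr_ne_zero hA hA0 hd,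
    h.irreducible hm, h.zeroLocus_eq hm⟩
  rw [HyperellipticCurve.smooth_curveToSpec_iff hm, Ne, h.evalPair_eq_zero_iff hm hA hB]
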